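/- Let $\varphi_k(t)=\sqrt{k+1/2}\,(2^kk!)^{-1}\frac{d^k}{dt^k}(t^2-1)^k$, $k=0,1,2,\dots$, be the Legendre polynomials orthonormal on $[-1,1]$, let $Q=[-1,1]^2$, and for $f\in L_2(Q)$ put $\langle f,\varphi_{k,j}\rangle=\int_{-1}^1\int_{-1}^1 f(t,\tau)\varphi_k(t)\varphi_j(\tau)\,d\tau\,dt$. For $1\le s<\infty$ and $\mu>0$ let $L^\mu_{s,2}$ be the space of all $f\in L_2(Q)$ with $$\|f\|_{s,\mu}^s:=\sum_{k,j=0}^\infty \max\{1,kj\}^{s\mu}\,|\langle f,\varphi_{k,j}\rangle|^s<\infty .$$ For integers $r_1,r_2\ge1$ put $$f^{(r_1,r_2)}(t,\tau)=\sum_{k\ge r_1,\ j\ge r_2}\langle f,\varphi_{k,j}\rangle\,\varphi_k^{(r_1)}(t)\varphi_j^{(r_2)}(\tau).$$ For $n>0$, $\gamma\ge1$ and a double sequence $y=(y_{k,j})$ of real numbers the truncation method is $$\mathcal D_{n,\gamma}^{(r_1,r_2)}y(t,\tau)=\sum_{k\ge r_1,\ j\ge r_2,\ kj^\gamma\le n}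 y_{k,j}\,\varphi_k^{(r_1)}(t)\varphi_j^{(r_2)}(\tau).$$ Let $1\le s<\infty$, $1\le p\le\infty$ (with $1/p=0$ for $p=\infty$), $r_1\ge r_2\ge1$, $\mu>2r_1-1/s+3/2$, and write $$M=\mu-\tfrac1p+\tfrac1s,\qquad E=\mu-2r_1+\tfrac1s-\tfrac32 ,\qquad \mathcal L=\ln\tfrac1\delta .$$ Let $\|\cdot\|_C$ be the uniform norm on $Q$. For $0<\delta<1$ let $y$ be any double sequence with $\|(\langle f,\varphi_{k,j}\rangle-y_{k,j})_{k,j}\|_{\ell_p}\le\delta$. For every $f\in L^\mu_{s,2}$ the series of $f^{(r_1,r_2)}$ converges (unconditionally) in $C(Q)$. Moreover, the following error bounds hold. In each of them $n$ is any real number with $aN(\delta)\le n\le bN(\delta)$, where $N(\delta)$ is the given function and $a,b>0$ are fixed (written $n\asymp N(\delta)$); $f$ is any element of $L^\mu_{s,2}$ with $\|f\|_{s,\mu}\le R$, where $R>0$ is fixed; and $c$ depends only on $s,\mu,p,r_1,r_2,\gamma,a,b,R$ and, in all parts except II b) and III a), on $\delta_0$. In II b) and III a) the noise level $\delta$ is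 any number in $(0,1)$; in all other parts it is any number in $(0,\delta_0]$, where $\delta_0\in(0,1)$ is arbitrary but fixed. I) If $r_1=r_2$, then for $n\asymp(\delta/\mathcal L^{1/p-1/s})^{-1/M}$ and $\gamma=1$: $$\|f^{(r_1,r_1)}-\mathcal D_{n,1}^{(r_1,r_1)}y\|_C\le c\,(\delta\,\mathcal L^{1/s-1/p})^{E/M}\,\mathcal L^{2-1/s}.$$ II) If $r_1=r_2+1$, then a) for $n\asymp\delta^{-1/M}$ and $\gamma=1$: $\ \|f^{(r_1,r_1-1)}-\mathcal D_{n,1}^{(r_1,r_1-1)}y\|_C\le c\,\delta^{E/M}\mathcal L$; b) for $n\asymp\delta^{-1/M}$ and any $\gamma\in\left(1,\frac{\mu-2r_1+1/s+5/2}{\mu-2r_1+1/s+1/2}\right)\cup\left(\frac{\mu-2r_1+1/s+5/2}{\mu-2r_1+1/s+1/2},\frac{\mu-2r_1+1/s+1/2}{\mu-2r_1+1/s-3/2}\right)$: $\ \|f^{(r_1,r_1-1)}-\mathcal D_{n,\gamma}^{(r_1,r_1-1)}y\|_C\le c\,\delta^{E/M}$; c) for $n\asymp(\delta/\mathcal L)^{-1/M}$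 and $\gamma=\frac{\mu-2r_1+1/s+1/2}{\mu-2r_1+1/s-3/2}$: $\ \|f^{(r_1,r_1-1)}-\mathcal D_{n,\gamma}^{(r_1,r_1-1)}y\|_C\le c\,(\delta/\mathcal L)^{E/M}\mathcal L$; d) for $n\asymp(\delta/\mathcal L^{1-1/s})^{-1/M}$ and $\gamma=\frac{\mu-2r_1+1/s+5/2}{\mu-2r_1+1/s+1/2}$: $\ \|f^{(r_1,r_1-1)}-\mathcal D_{n,\gamma}^{(r_1,r_1-1)}y\|_C\le c\,(\delta/\mathcal L^{1-1/s})^{E/M}\mathcal L^{1-1/s}$. III) If $r_1>r_2+1$, then a) for $n\asymp\delta^{-1/M}$ and any $\gamma\in\left[1,\frac{\mu-2r_2+1/s-3/2}{\mu-2r_1+1/s+1/2}\right)\cup\left(\frac{\mu-2r_2+1/s-3/2}{\mu-2r_1+1/s+1/2},\frac{\mu-2r_2+1/s+1/2}{\mu-2r_1+1/s+1/2}\right)\cup\left(\frac{\mu-2r_2+1/s+1/2}{\mu-2r_1+1/s+1/2},\frac{\mu-2r_2+1/s-3/2}{\mu-2r_1+1/s-3/2}\right)$: $\ \|f^{(r_1,r_2)}-\mathcal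 D_{n,\gamma}^{(r_1,r_2)}y\|_C\le c\,\delta^{E/M}$; b) for $n\asymp(\delta/\mathcal L)^{-1/M}$ and $\gamma=\frac{\mu-2r_2+1/s-3/2}{\mu-2r_1+1/s+1/2}$ or $\gamma=\frac{\mu-2r_2+1/s-3/2}{\mu-2r_1+1/s-3/2}$: $\ \|f^{(r_1,r_2)}-\mathcal D_{n,\gamma}^{(r_1,r_2)}y\|_C\le c\,(\delta/\mathcal L)^{E/M}\mathcal L$; c) for $n\asymp(\delta/\mathcal L^{1-1/s})^{-1/M}$ and $\gamma=\frac{\mu-2r_2+1/s+1/2}{\mu-2r_1+1/s+1/2}$: $\ \|f^{(r_1,r_2)}-\mathcal D_{n,\gamma}^{(r_1,r_2)}y\|_C\le c\,(\delta/\mathcal L^{1-1/s})^{E/M}\mathcal L^{1-1/s}$. -/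

import Mathlib

open Set MeasureTheory
open scoped ENNReal

noncomputable section

namespace FourierLegendre

/-- The `k`-th Legendre polynomial, orthonormal on `[-1, 1]`, given by Rodrigues' formula
`√(k + 1/2) (2 ^ k k!)⁻¹ (d/dt)^k (t² - 1)^k`. -/
def phi (k : ℕ) : Polynomial ℝ :=
  Polynomial.C (Real.sqrt ((k : ℝ) + 1 / 2) * ((2 : ℝ) ^ k * (k.factorial : ℝ))⁻¹) *
    Polynomial.derivative^[k] ((Polynomial.X ^ 2 - 1) ^ k)

/-- The square `Q = [-1, 1]²` as a subset of the plane. -/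
def squareQ : Set (ℝ × ℝ) := Icc (-1) 1 ×ˢ Icc (-1) 1

/-- The space `C(Q)` of continuous functions on `Q = [-1, 1]²`, with the uniform norm. -/
abbrev CQ : Type := C(Icc (-1 : ℝ) 1 × Icc (-1 : ℝ) 1, ℝ)

/-- The Fourier-Legendre coefficient `⟨f, φ_{k,j}⟩`, `q = (k, j)`. -/
def coeff (f : ℝ × ℝ → ℝ) (q : ℕ × ℕ) : ℝ :=
  ∫ t in (-1 : ℝ)..1, ∫ τ in (-1 : ℝ)..1,
    f (t, τ) * (phi q.1).eval t * (phi q.2).eval τ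

/-- The summand of `‖f‖_{s,μ} ^ s` with index `q = (k, j)`;
the weight is the power `s μ` of `max {1, k j}`. -/
def smoothTerm (s μ : ℝ) (f : ℝ × ℝ → ℝ) (q : ℕ × ℕ) : ℝ :=
  (max 1 ((q.1 : ℝ) * (q.2 : ℝ))) ^ (s * μ) * |coeff f q| ^ s

/-- The norm `‖f‖_{s,μ}`, for functions for which the series converges. -/
def smoothNorm (s μ : ℝ) (f : ℝ × ℝ → ℝ) : ℝ :=
  (∑' q : ℕ × ℕ, smoothTerm s μ f q) ^ (1 / s)

/-- The space `L^μ_{s,2}(Q)`. -/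
def smoothSpace (s μ : ℝ) : Set (ℝ × ℝ → ℝ) :=
  {f | MemLp f 2 (volume.restrict squareQ) ∧ Summable (smoothTerm s μ f)}

/-- The function `(t, τ) ↦ φ_k^{(r₁)}(t) φ_j^{(r₂)}(τ)` on `Q`, where `q = (k, j)`. -/
def phiDeriv (r₁ r₂ : ℕ) (q : ℕ × ℕ) : CQ where
  toFun x := (Polynomial.derivative^[r₁] (phi q.1)).eval (x.1 : ℝ) *
    (Polynomial.derivative^[r₂] (phi q.2)).eval (x.2 : ℝ)
  continuous_toFun := by fun_prop

/-- The summand of the series of the mixed derivative of `f`; the indices run over `k ≥ r₁`,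
`j ≥ r₂`. -/
def derivTerm (r₁ r₂ : ℕ) (f : ℝ × ℝ → ℝ) (q : Ici (r₁, r₂)) : CQ :=
  coeff f q • phiDeriv r₁ r₂ q

/-- The mixed derivative `f^{(r₁,r₂)}`, the sum in `C(Q)` of its Fourier-Legendre series. -/
def mixedDeriv (r₁ r₂ : ℕ) (f : ℝ × ℝ → ℝ) : CQ :=
  ∑' q : Ici (r₁, r₂), derivTerm r₁ r₂ f q

/-- The hyperbolic cross `Γ_{n,γ}`: the index pairs `(k, j)` with `k j ^ γ ≤ n`,
`r₁ ≤ k ≤ n / r₂ ^ γ` and `r₂ ≤ j ≤ (n / r₁) ^ (1 / γ)`. -/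
def hyperbolicCross (r₁ r₂ : ℕ) (n γ : ℝ) : Finset (ℕ × ℕ) :=
  (Finset.Icc r₁ ⌊n / (r₂ : ℝ) ^ γ⌋₊ ×ˢ Finset.Icc r₂ ⌊(n / (r₁ : ℝ)) ^ (1 / γ)⌋₊).filter
    fun q => (q.1 : ℝ) * (q.2 : ℝ) ^ γ ≤ n

/-- The truncation method on the hyperbolic cross, applied to the data `y` (a double sequence
of perturbed Fourier-Legendre coefficients). -/
def truncation (r₁ r₂ : ℕ) (n γ : ℝ) (y : ℕ × ℕ → ℝ) : CQ :=
  ∑ q ∈ hyperbolicCross r₁ r₂ n γ, y q • phiDeriv r₁ r₂ q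

/-- `y` is a double sequence whose distance in `ℓ_p` to the Fourier-Legendre coefficients of `f`
is at most `δ`. -/
def IsPerturbation (p : ℝ≥0∞) (δ : ℝ) (f : ℝ × ℝ → ℝ) (y : ℕ × ℕ → ℝ) : Prop :=
  ∃ ξ : lp (fun _ : ℕ × ℕ => ℝ) p, (∀ q, ξ q = coeff f q - y q) ∧ ‖ξ‖ ≤ δ

/-- For all noise levels `δ ∈ Δ` and all `n` with `n ≍ N δ`, the truncation method with
parameters `n` and `γ` has an error at most `c * ε δ` in the uniform norm. The constant `c` is
uniform over `δ`, over `n` with given constants `a`, `b` in the relation `≍`, over `f` in a ball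
of `L^μ_{s,2}` and over all perturbed data. -/
def UniformErrorBound (s μ : ℝ) (p : ℝ≥0∞) (r₁ r₂ : ℕ) (γ : ℝ) (Δ : Set ℝ)
    (N ε : ℝ → ℝ) : Prop :=
  ∀ a b R : ℝ, 0 < a → 0 < b → 0 < R → ∃ c : ℝ, 0 < c ∧
    ∀ δ ∈ Δ, ∀ n : ℝ, a * N δ ≤ n → n ≤ b * N δ →
    ∀ f ∈ smoothSpace s μ, smoothNorm s μ f ≤ R →
    ∀ y : ℕ × ℕ → ℝ, IsPerturbation p δ f y →
      ‖mixedDeriv r₁ r₂ f - truncation r₁ r₂ n γ y‖ ≤ c * ε δ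

end FourierLegendre

end

/-!
The proof rests on the bound `|φ_k^{(r)}| ≤ 2 k^{2r + 1/2}` on `[-1, 1]`
(`abs_iterate_derivative_phi_le`). Rodrigues' formula gives recurrences for the classical Legendre
polynomials `P_k`. Two of them, for `P_{k+1}` and `P_{k+1}'` in terms of `P_k` and `P_k'`, preserve
the quadratic form `(k+1)² P² + (1 - x²) P'²`, whence `|P_k| ≤ 1`. The third one,
`P_{k+2}' - P_k' = (2k+3) P_{k+1}`, yields `|P_k^{(r)}| ≤ k^{2r}` by induction.

The error of the truncation method is the sum of the terms of `f^{(r₁,r₂)}` outside the hyperbolic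
cross and of the data error on the cross. Hölder's inequality bounds the first one by `‖f‖_{s,μ}`
times the `ℓ_{s'}` norm of `k^{-(μ-2r₁-1/2)} j^{-(μ-2r₂-1/2)}` outside the cross
(`exists_finNormLE_outside`), and the second one by `δ` times the `ℓ_{p'}` norm of
`k^{2r₁+1/2} j^{2r₂+1/2}` over the cross (`exists_finNormLE_inside`). Summation over `k` first and
then over `j` shows that the two norms have the orders `n^{-E}` and `n^{M-E}`. A power of `log n`
enters only when the remaining sum over `j` is harmonic, that is, at the critical value
`γ = (E + 2(r₁-r₂)) / E` for the first norm and at `γ = 1`, `r₁ = r₂` for the second.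

With `n ≍ (δ/Λ)^{-1/M}` both errors become `(δ/Λ)^{E/M}` up to logarithmic factors
(`uniformErrorBound_of_logFactor_le`). All `γ` in the statement lie in `[1, (E + 2(r₁-r₂)) / E]`,
and each case is a choice of `Λ` together with a comparison of powers of `log (1/δ)`.
-/

namespace FourierLegendre

/-! ### Legendre polynomials and their derivatives on `[-1, 1]` -/

open Polynomial in
/-- The Legendre polynomial `P_k` with the classical normalization `P_k(1) = 1`, given by
Rodrigues' formula. -/
noncomputable def legendre (k : ℕ) : Polynomial ℝ :=
  C (((2 : ℝ) ^ k * (k.factorial : ℝ))⁻¹) * derivative^[k] ((X ^ 2 - 1) ^ k)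

section Recurrences

open Polynomial

theorem derivative_X_sq_sub_one_pow_succ (m : ℕ) :
    derivative ((X ^ 2 - 1 : ℝ[X]) ^ (m + 1)) =
      C (2 * ((m : ℝ) + 1)) * ((X ^ 2 - 1) ^ m * X) := by
  rw [derivative_pow_succ]
  simp [map_ofNat C 2]
  ring

theorem legendre_zero : legendre 0 = 1 := by
  simp [legendre]

theorem legendre_succ_eq (m : ℕ) :
    legendre (m + 1) = C (((2 : ℝ) ^ m * (m.factorial : ℝ))⁻¹) *
      derivative^[m] ((X ^ 2 - 1) ^ m * X) := by
  rw [legendre, Function.iterate_succ_apply, derivative_X_sq_sub_one_pow_succ,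
    iterate_derivative_C_mul, ← mul_assoc, ← C_mul]
  congr 2
  have : (m.factorial : ℝ) ≠ 0 := by positivity
  push_cast [Nat.factorial_succ, pow_succ]
  field_simp

theorem derivative_legendre_succ (m : ℕ) :
    derivative (legendre (m + 1)) =
      X * derivative (legendre m) + C ((m : ℝ) + 1) * legendre m := by
  rw [legendre_succ_eq, derivative_C_mul, ← Function.iterate_succ_apply' derivative,
    iterate_derivative_mul_X, legendre, derivative_C_mul, ← Function.iterate_succ_apply' derivative]
  simp only [Nat.add_sub_cancel, Nat.succ_eq_add_one, nsmul_eq_mul]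
  simp
  ring

/-- Applying `(d/dx)^m` to `u (u^m)' = 2 m x u^m`, where `u = x² - 1`, gives an identity that
expresses the antiderivative of `(d/dx)^m u^m`. -/
theorem X_sq_sub_one_mul_iterate_derivative (m : ℕ) :
    (X ^ 2 - 1 : ℝ[X]) * derivative^[m + 2] ((X ^ 2 - 1) ^ (m + 1)) =
      C (((m : ℝ) + 1) * (m + 2)) * derivative^[m] ((X ^ 2 - 1) ^ (m + 1)) := by
  have h : derivative ((X ^ 2 - 1 : ℝ[X]) ^ (m + 1)) * X * X -
      derivative ((X ^ 2 - 1 : ℝ[X]) ^ (m + 1)) =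
      C (2 * ((m : ℝ) + 1)) * ((X ^ 2 - 1) ^ (m + 1) * X) := by
    rw [derivative_X_sq_sub_one_pow_succ]; ring
  have h2 := congrArg (fun p => derivative^[m + 1] p) h
  simp only [iterate_derivative_sub, iterate_derivative_C_mul, iterate_derivative_mul_X,
    Nat.add_sub_cancel, ← Function.iterate_succ_apply] at h2
  simp only [nsmul_eq_mul, Nat.succ_eq_add_one] at h2
  have e : (m + 1 + 1 : ℕ) = m + 2 := rfl
  simp only [map_mul, map_add, map_natCast, map_one, map_ofNat, e] at h2 ⊢
  push_cast at h2 ⊢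
  rcases m with _ | m
  · simp at h2 ⊢
    linear_combination h2
  · simp only [Nat.add_sub_cancel] at h2
    push_cast at h2 ⊢
    linear_combination h2

theorem legendre_succ (m : ℕ) :
    C ((m : ℝ) + 1) * legendre (m + 1) =
      C ((m : ℝ) + 1) * (X * legendre m) + (X ^ 2 - 1) * derivative (legendre m) := by
  rw [legendre_succ_eq, iterate_derivative_mul_X, legendre, derivative_C_mul,
    ← Function.iterate_succ_apply' derivative]
  rcases m with _ | m
  · simp
  · have h := X_sq_sub_one_mul_iterate_derivative m
    have e : (m + 1).succ = m + 2 := rfl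
    simp only [e, nsmul_eq_mul, Nat.add_sub_cancel, map_mul, map_add, map_natCast, map_one,
      map_ofNat] at h ⊢
    push_cast at h ⊢
    linear_combination -(C (((2 : ℝ) ^ (m + 1) * ((m + 1).factorial : ℝ))⁻¹)) * h

theorem derivative_legendre_add_two (m : ℕ) :
    derivative (legendre (m + 2)) =
      C (2 * (m : ℝ) + 3) * legendre (m + 1) + derivative (legendre m) := by
  have h1 : derivative ((X ^ 2 - 1 : ℝ[X]) ^ (m + 1) * X) =
      C (2 * (m : ℝ) + 3) * (X ^ 2 - 1) ^ (m + 1) + C (2 * ((m : ℝ) + 1)) * (X ^ 2 - 1) ^ m := by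
    rw [derivative_mul, derivative_X_sq_sub_one_pow_succ]
    simp only [map_mul, map_add, map_natCast, map_one, map_ofNat, derivative_X]
    ring
  rw [show m + 2 = (m + 1) + 1 from rfl, legendre_succ_eq, derivative_C_mul,
    ← Function.iterate_succ_apply' derivative, Function.iterate_succ_apply, h1,
    iterate_map_add, iterate_derivative_C_mul, iterate_derivative_C_mul, legendre, legendre,
    derivative_C_mul, ← Function.iterate_succ_apply' derivative, mul_add]
  congr 1
  · ring
  · rw [← mul_assoc, ← C_mul]
    congr 2
    have : (m.factorial : ℝ) ≠ 0 := by positivity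
    push_cast [Nat.factorial_succ, pow_succ]
    field_simp

end Recurrences

/-- The two recurrences expressing `P_{k+1}` and `P_{k+1}'` through `P_k` and `P_k'` preserve the
quadratic form `(k+1)² P² + (1 - x²) P'²`; induction on `k` therefore bounds it. -/
theorem legendre_energy_le (k : ℕ) {x : ℝ} (hx : x ∈ Icc (-1 : ℝ) 1) :
    (k : ℝ) ^ 2 * (legendre k).eval x ^ 2 +
      (1 - x ^ 2) * (Polynomial.derivative (legendre k)).eval x ^ 2 ≤ (k : ℝ) ^ 2 ∧
    (legendre k).eval x ^ 2 ≤ 1 := by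
  have hx2 : 0 ≤ 1 - x ^ 2 := by nlinarith [hx.1, hx.2]
  induction k with
  | zero => simp [legendre_zero]
  | succ k ih =>
    have hA := congrArg (Polynomial.eval x) (derivative_legendre_succ k)
    have hB := congrArg (Polynomial.eval x) (legendre_succ k)
    simp only [Polynomial.eval_add, Polynomial.eval_mul, Polynomial.eval_C, Polynomial.eval_X,
      Polynomial.eval_sub, Polynomial.eval_pow, Polynomial.eval_one] at hA hB
    set p := (legendre k).eval x
    set p' := (Polynomial.derivative (legendre k)).eval x
    set q := (legendre (k + 1)).eval x
    set q' := (Polynomial.derivative (legendre (k + 1))).eval x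
    have hk : (0 : ℝ) ≤ k := by positivity
    have key : ((k : ℝ) + 1) ^ 2 * q ^ 2 + (1 - x ^ 2) * q' ^ 2 =
        ((k : ℝ) + 1) ^ 2 * p ^ 2 + (1 - x ^ 2) * p' ^ 2 := by
      have : ((k : ℝ) + 1) ^ 2 * q ^ 2 = (((k : ℝ) + 1) * q) ^ 2 := by ring
      rw [this, hB, hA]; ring
    have h1 : ((k : ℝ) + 1) ^ 2 * q ^ 2 + (1 - x ^ 2) * q' ^ 2 ≤ ((k : ℝ) + 1) ^ 2 := by
      rw [key]; nlinarith [ih.1, ih.2]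
    push_cast
    refine ⟨h1, ?_⟩
    have h2 : ((k : ℝ) + 1) ^ 2 * q ^ 2 ≤ ((k : ℝ) + 1) ^ 2 * 1 := by
      nlinarith [mul_nonneg hx2 (sq_nonneg q')]
    exact le_of_mul_le_mul_left h2 (by positivity)

theorem abs_iterate_derivative_legendre_le (r k : ℕ) {x : ℝ} (hx : x ∈ Icc (-1 : ℝ) 1) :
    |(Polynomial.derivative^[r] (legendre k)).eval x| ≤ (k : ℝ) ^ (2 * r) := by
  induction r generalizing k with
  | zero =>
    simpa using (sq_le_one_iff_abs_le_one _).1 (legendre_energy_le k hx).2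
  | succ r ih =>
    -- two-step induction on `k`: `(k-1)^{2r+2} + (2k+1) k^{2r} ≤ (k+1)^{2r+2}`
    induction k using Nat.twoStepInduction with
    | zero => simp [legendre_zero]
    | one =>
      have h : Polynomial.derivative (legendre 1) = legendre 0 := by
        rw [show (1 : ℕ) = 0 + 1 from rfl, derivative_legendre_succ]; simp [legendre_zero]
      rw [Function.iterate_succ_apply, h]
      refine (ih 0).trans ?_
      rw [Nat.cast_one, one_pow]
      exact pow_le_one₀ (by simp) (by simp)
    | more m h0 _ =>
      rw [Function.iterate_succ_apply] at h0 ⊢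
      rw [derivative_legendre_add_two, iterate_map_add,
        Polynomial.iterate_derivative_C_mul, Polynomial.eval_add, Polynomial.eval_mul,
        Polynomial.eval_C]
      have hm : (0 : ℝ) ≤ m := by positivity
      have h1 := ih (m + 1)
      push_cast at h1 ⊢
      calc _ ≤ (2 * (m : ℝ) + 3) * ((m : ℝ) + 1) ^ (2 * r) + (m : ℝ) ^ (2 * (r + 1)) := by
            refine (abs_add_le _ _).trans (add_le_add ?_ h0)
            rw [abs_mul, abs_of_nonneg (by positivity)]
            gcongr
        _ = (2 * (m : ℝ) + 3) * ((m : ℝ) + 1) ^ (2 * r) + (m : ℝ) ^ (2 * r) * (m : ℝ) ^ 2 := by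
            ring
        _ ≤ (2 * (m : ℝ) + 3) * ((m : ℝ) + 2) ^ (2 * r) + (m + 2 : ℝ) ^ (2 * r) * (m : ℝ) ^ 2 := by
            gcongr <;> linarith
        _ = (m + 2 : ℝ) ^ (2 * r) * ((m : ℝ) ^ 2 + 2 * m + 3) := by ring
        _ ≤ (m + 2 : ℝ) ^ (2 * r) * (m + 2 : ℝ) ^ 2 := by gcongr; nlinarith
        _ = _ := by ring

theorem phi_eq (k : ℕ) :
    phi k = Polynomial.C (Real.sqrt ((k : ℝ) + 1 / 2)) * legendre k := by
  rw [phi, legendre, Polynomial.C_mul, mul_assoc]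

theorem abs_iterate_derivative_phi_le (r : ℕ) {k : ℕ} (hk : 1 ≤ k) {x : ℝ}
    (hx : x ∈ Icc (-1 : ℝ) 1) :
    |(Polynomial.derivative^[r] (phi k)).eval x| ≤ 2 * (k : ℝ) ^ (2 * (r : ℝ) + 1 / 2) := by
  have hk' : (1 : ℝ) ≤ k := by exact_mod_cast hk
  have h0 : (0 : ℝ) < k := by linarith
  rw [phi_eq, Polynomial.iterate_derivative_C_mul, Polynomial.eval_mul, Polynomial.eval_C, abs_mul,
    abs_of_nonneg (Real.sqrt_nonneg _)]
  have h1 : Real.sqrt ((k : ℝ) + 1 / 2) ≤ 2 * (k : ℝ) ^ (1 / 2 : ℝ) := by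
    rw [← Real.sqrt_eq_rpow, show (2 : ℝ) = Real.sqrt 4 by norm_num, ← Real.sqrt_mul (by norm_num)]
    exact Real.sqrt_le_sqrt (by linarith)
  calc _ ≤ (2 * (k : ℝ) ^ (1 / 2 : ℝ)) * (k : ℝ) ^ (2 * r) :=
        mul_le_mul h1 (abs_iterate_derivative_legendre_le r k hx) (abs_nonneg _) (by positivity)
    _ = _ := by
        rw [Real.rpow_add h0, show (2 * (r : ℝ)) = ((2 * r : ℕ) : ℝ) by push_cast; ring,
          Real.rpow_natCast]
        ring

theorem norm_phiDeriv_le (r₁ r₂ : ℕ) {q : ℕ × ℕ} (h1 : 1 ≤ q.1) (h2 : 1 ≤ q.2) :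
    ‖phiDeriv r₁ r₂ q‖ ≤
      4 * ((q.1 : ℝ) ^ (2 * (r₁ : ℝ) + 1 / 2) * (q.2 : ℝ) ^ (2 * (r₂ : ℝ) + 1 / 2)) := by
  rw [ContinuousMap.norm_le _ (by positivity)]
  intro x
  change |(Polynomial.derivative^[r₁] (phi q.1)).eval (x.1 : ℝ) *
    (Polynomial.derivative^[r₂] (phi q.2)).eval (x.2 : ℝ)| ≤ _
  rw [abs_mul]
  calc _ ≤ (2 * (q.1 : ℝ) ^ (2 * (r₁ : ℝ) + 1 / 2)) * (2 * (q.2 : ℝ) ^ (2 * (r₂ : ℝ) + 1 / 2)) :=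
        mul_le_mul (abs_iterate_derivative_phi_le r₁ h1 x.1.2)
          (abs_iterate_derivative_phi_le r₂ h2 x.2.2) (abs_nonneg _) (by positivity)
    _ = _ := by ring

/-! ### Hölder's inequality with endpoint exponents -/

/-- The `ℓ_{1/θ}` norm of the nonnegative family `w` over the finite set `S` is at most `K`; for
`θ = 0` this is the maximum norm. In this parametrization the exponents `θ` and `1 - θ` are
conjugate to each other for every `θ ∈ [0, 1]`, the endpoints included. -/
def FinNormLE {ι : Type*} (θ : ℝ) (S : Finset ι) (w : ι → ℝ) (K : ℝ) : Prop :=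
  (θ = 0 → ∀ q ∈ S, w q ≤ K) ∧ (0 < θ → ∑ q ∈ S, w q ^ (1 / θ) ≤ K ^ (1 / θ))

theorem FinNormLE.sum_mul_le {ι : Type*} {θ : ℝ} {S : Finset ι} {x w : ι → ℝ} {X K : ℝ}
    (h0 : 0 ≤ θ) (h1 : θ ≤ 1) (hx : ∀ q ∈ S, 0 ≤ x q) (hw : ∀ q ∈ S, 0 ≤ w q) (hX : 0 ≤ X)
    (hK : 0 ≤ K) (H1 : FinNormLE (1 - θ) S x X) (H2 : FinNormLE θ S w K) :
    ∑ q ∈ S, x q * w q ≤ X * K := by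
  rcases h0.eq_or_lt with rfl | h0
  · have h := H1.2 (by norm_num)
    simp only [sub_zero, div_one, Real.rpow_one] at h
    calc _ ≤ ∑ q ∈ S, x q * K :=
          Finset.sum_le_sum fun q hq => mul_le_mul_of_nonneg_left (H2.1 rfl q hq) (hx q hq)
      _ = (∑ q ∈ S, x q) * K := by rw [Finset.sum_mul]
      _ ≤ _ := by gcongr
  rcases h1.eq_or_lt with rfl | h1
  · have h := H2.2 (by norm_num)
    simp only [div_one, Real.rpow_one] at h
    calc _ ≤ ∑ q ∈ S, X * w q :=
          Finset.sum_le_sum fun q hq =>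
            mul_le_mul_of_nonneg_right (H1.1 (by norm_num) q hq) (hw q hq)
      _ = X * ∑ q ∈ S, w q := by rw [Finset.mul_sum]
      _ ≤ _ := by gcongr
  have h1' : 0 < 1 - θ := by linarith
  have hc : Real.HolderConjugate (1 / (1 - θ)) (1 / θ) := by
    rw [Real.holderConjugate_iff]
    constructor
    · rw [lt_div_iff₀ h1']; linarith
    · simp
  refine (Real.inner_le_Lp_mul_Lq_of_nonneg S hc hx hw).trans ?_
  simp only [one_div_one_div]
  have e1 : X = (X ^ (1 / (1 - θ))) ^ (1 - θ) := by
    rw [← Real.rpow_mul hX, one_div_mul_cancel h1'.ne', Real.rpow_one]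
  have e2 : K = (K ^ (1 / θ)) ^ θ := by
    rw [← Real.rpow_mul hK, one_div_mul_cancel h0.ne', Real.rpow_one]
  rw [e1, e2]
  have hs1 : 0 ≤ ∑ q ∈ S, x q ^ (1 / (1 - θ)) :=
    Finset.sum_nonneg fun q hq => Real.rpow_nonneg (hx q hq) _
  have hs2 : 0 ≤ ∑ q ∈ S, w q ^ (1 / θ) :=
    Finset.sum_nonneg fun q hq => Real.rpow_nonneg (hw q hq) _
  exact mul_le_mul (Real.rpow_le_rpow hs1 (H1.2 h1') h1'.le)
    (Real.rpow_le_rpow hs2 (H2.2 h0) h0.le) (Real.rpow_nonneg hs2 _)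
    (Real.rpow_nonneg (Real.rpow_nonneg hX _) _)

theorem finNormLE_monomial_of_sum_le {θ A B a n L : ℝ} (hθ : 0 < θ) (hn : 0 < n) (hL : 0 ≤ L)
    {S : Finset (ℕ × ℕ)}
    (h : ∑ q ∈ S, (q.1 : ℝ) ^ (A / θ) * (q.2 : ℝ) ^ (B / θ) ≤ n ^ (a / θ) * L) :
    FinNormLE θ S (fun q => (q.1 : ℝ) ^ A * (q.2 : ℝ) ^ B) (n ^ a * L ^ θ) := by
  refine ⟨fun h0 => absurd h0 hθ.ne', fun _ => ?_⟩
  have e : ∀ q : ℕ × ℕ, ((q.1 : ℝ) ^ A * (q.2 : ℝ) ^ B) ^ (1 / θ) =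
      (q.1 : ℝ) ^ (A / θ) * (q.2 : ℝ) ^ (B / θ) := fun q => by
    rw [Real.mul_rpow (by positivity) (by positivity), ← Real.rpow_mul (by positivity),
      ← Real.rpow_mul (by positivity), mul_one_div, mul_one_div]
  simp only [e]
  rw [Real.mul_rpow (by positivity) (by positivity), ← Real.rpow_mul hn.le, ← Real.rpow_mul hL,
    mul_one_div, mul_one_div_cancel hθ.ne', Real.rpow_one]
  exact h

theorem sum_le_sum_of_fiber_le (S : Finset (ℕ × ℕ)) (F : ℕ × ℕ → ℝ) (G : ℕ → ℝ)
    (h : ∀ j ∈ S.image Prod.snd, ∀ T : Finset ℕ, (∀ k ∈ T, (k, j) ∈ S) → ∑ k ∈ T, F (k, j) ≤ G j) :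
    ∑ q ∈ S, F q ≤ ∑ j ∈ S.image Prod.snd, G j := by
  rw [← Finset.sum_fiberwise_of_maps_to (fun q hq => Finset.mem_image_of_mem Prod.snd hq)]
  refine Finset.sum_le_sum fun j hj => ?_
  have e : ∑ q ∈ S with q.2 = j, F q =
      ∑ k ∈ (S.filter fun q => q.2 = j).image Prod.fst, F (k, j) := by
    rw [Finset.sum_image]
    · refine Finset.sum_congr rfl fun q hq => ?_
      rw [← (Finset.mem_filter.1 hq).2]
    · intro p hp q hq hpq
      simp only [Finset.coe_filter, mem_ofPred_eq] at hp hq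
      exact Prod.ext hpq (hp.2.trans hq.2.symm)
  rw [e]
  refine h j hj _ fun k hk => ?_
  obtain ⟨q, hq, rfl⟩ := Finset.mem_image.1 hk
  have := Finset.mem_filter.1 hq
  rw [← this.2]
  exact this.1

/-! ### One-dimensional power sums -/

theorem sum_rpow_le_of_le {a x : ℝ} (ha : 0 ≤ a) {T : Finset ℕ} (hx : 0 < x)
    (hT : ∀ k ∈ T, 1 ≤ k ∧ (k : ℝ) ≤ x) : ∑ k ∈ T, (k : ℝ) ^ a ≤ x ^ (a + 1) := by
  have hc : (T.card : ℝ) ≤ x := by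
    have h : T ⊆ Finset.Icc 1 ⌊x⌋₊ := fun k hk =>
      Finset.mem_Icc.2 ⟨(hT k hk).1, Nat.le_floor (hT k hk).2⟩
    have h2 := Finset.card_le_card h
    rw [Nat.card_Icc, Nat.add_sub_cancel] at h2
    exact (Nat.cast_le.2 h2).trans (Nat.floor_le hx.le)
  calc _ ≤ ∑ k ∈ T, x ^ a :=
        Finset.sum_le_sum fun k hk => Real.rpow_le_rpow (by positivity) (hT k hk).2 ha
    _ = T.card * x ^ a := by rw [Finset.sum_const, nsmul_eq_mul]
    _ ≤ x * x ^ a := by gcongr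
    _ = _ := by rw [Real.rpow_add hx, Real.rpow_one, mul_comm]

theorem rpow_neg_succ_le_sub {b : ℝ} (hb : 0 < b) {m : ℕ} (hm : 1 ≤ m) :
    b * ((m + 1 : ℕ) : ℝ) ^ (-(b + 1)) ≤ (m : ℝ) ^ (-b) - ((m + 1 : ℕ) : ℝ) ^ (-b) := by
  have hm0 : (0 : ℝ) < m := by exact_mod_cast hm
  push_cast
  have h1 : 0 < (m : ℝ) + 1 := by positivity
  have hlog : 1 / ((m : ℝ) + 1) ≤ Real.log (m + 1) - Real.log m := by
    rw [← Real.log_div h1.ne' hm0.ne']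
    have := Real.one_sub_inv_le_log_of_pos (div_pos h1 hm0)
    refine le_trans (le_of_eq ?_) this
    field_simp
    ring
  have h2 : 1 + b / (m + 1) ≤ (m : ℝ) ^ (-b) * (m + 1) ^ b := by
    rw [Real.rpow_def_of_pos hm0, Real.rpow_def_of_pos h1, ← Real.exp_add]
    have h3 := Real.add_one_le_exp (Real.log m * -b + Real.log (m + 1) * b)
    have h4 := mul_le_mul_of_nonneg_left hlog hb.le
    rw [mul_one_div] at h4
    linarith
  have h5 : (m : ℝ) ^ (-b) = ((m : ℝ) ^ (-b) * (m + 1) ^ b) * (m + 1) ^ (-b) := by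
    rw [mul_assoc, ← Real.rpow_add h1, add_neg_cancel, Real.rpow_zero, mul_one]
  have h6 : ((m : ℝ) + 1) ^ (-(b + 1)) = (m + 1) ^ (-b) / (m + 1) := by
    rw [neg_add, ← sub_eq_add_neg, Real.rpow_sub h1, Real.rpow_one]
  rw [h5, h6]
  have h7 : 0 < ((m : ℝ) + 1) ^ (-b) := by positivity
  calc _ = (1 + b / (m + 1)) * ((m : ℝ) + 1) ^ (-b) - ((m : ℝ) + 1) ^ (-b) := by
        field_simp
        ring
    _ ≤ _ := by gcongr

theorem sum_Ioc_rpow_neg_le {b : ℝ} (hb : 0 < b) {m : ℕ} (hm : 1 ≤ m) (N : ℕ) :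
    ∑ k ∈ Finset.Ioc m N, (k : ℝ) ^ (-(b + 1)) ≤ (m : ℝ) ^ (-b) / b := by
  rw [le_div_iff₀ hb]
  rcases le_or_gt m N with h | h
  · suffices H : (∑ k ∈ Finset.Ioc m N, (k : ℝ) ^ (-(b + 1))) * b ≤
        (m : ℝ) ^ (-b) - (N : ℝ) ^ (-b) from
      H.trans (sub_le_self _ (by positivity))
    induction N, h using Nat.le_induction with
    | base => simp
    | succ N hN ih =>
      rw [Finset.sum_Ioc_succ_top hN, add_mul]
      have := rpow_neg_succ_le_sub hb (hm.trans hN)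
      linarith
  · rw [Finset.Ioc_eq_empty_of_le h.le]
    simp
    positivity

theorem exists_sum_rpow_neg_le {b : ℝ} (hb : 0 < b) : ∃ C : ℝ, 0 < C ∧ ∀ T : Finset ℕ,
    (∀ k ∈ T, 1 ≤ k) → ∑ k ∈ T, (k : ℝ) ^ (-(b + 1)) ≤ C := by
  refine ⟨1 + 1 / b, by positivity, fun T hT => ?_⟩
  have h : T ⊆ insert 1 (Finset.Ioc 1 (T.sup id)) := fun k hk => by
    have h1 := hT k hk
    have h2 : k ≤ T.sup id := Finset.le_sup (f := id) hk
    simp only [Finset.mem_insert, Finset.mem_Ioc]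
    omega
  refine (Finset.sum_le_sum_of_subset_of_nonneg h fun _ _ _ => by positivity).trans ?_
  rw [Finset.sum_insert (by simp)]
  have := sum_Ioc_rpow_neg_le hb le_rfl (T.sup id)
  simp only [Nat.cast_one, Real.one_rpow] at this ⊢
  linarith

theorem exists_sum_rpow_neg_tail_le {b : ℝ} (hb : 0 < b) : ∃ C : ℝ, 0 < C ∧ ∀ x : ℝ, 0 < x →
    ∀ T : Finset ℕ, (∀ k ∈ T, 1 ≤ k ∧ x < (k : ℝ)) →
      ∑ k ∈ T, (k : ℝ) ^ (-(b + 1)) ≤ C * x ^ (-b) := by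
  obtain ⟨C, hC, h⟩ := exists_sum_rpow_neg_le hb
  refine ⟨C + 2 ^ b / b, by positivity, fun x hx T hT => ?_⟩
  rw [add_mul]
  rcases lt_or_ge x 1 with hx1 | hx1
  · have h1 : 1 ≤ x ^ (-b) := Real.one_le_rpow_of_pos_of_le_one_of_nonpos hx hx1.le (by linarith)
    have h2 := h T fun k hk => (hT k hk).1
    have h3 : C * 1 ≤ C * x ^ (-b) := by gcongr
    have h4 : 0 ≤ 2 ^ b / b * x ^ (-b) := by positivity
    linarith
  · have hm : 1 ≤ ⌊x⌋₊ := Nat.one_le_floor_iff x |>.2 hx1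
    have hsub : T ⊆ Finset.Ioc ⌊x⌋₊ (T.sup id) := fun k hk => by
      refine Finset.mem_Ioc.2 ⟨?_, Finset.le_sup (f := id) hk⟩
      exact (Nat.floor_lt hx.le).2 (hT k hk).2
    have h1 := (Finset.sum_le_sum_of_subset_of_nonneg hsub fun _ _ _ => by positivity).trans
      (sum_Ioc_rpow_neg_le hb hm (T.sup id))
    have h2 : x / 2 ≤ (⌊x⌋₊ : ℝ) := by
      have := Nat.lt_floor_add_one x
      have : (1 : ℝ) ≤ (⌊x⌋₊ : ℝ) := by exact_mod_cast hm
      linarith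
    have h3 : (⌊x⌋₊ : ℝ) ^ (-b) ≤ (x / 2) ^ (-b) :=
      Real.rpow_le_rpow_of_nonpos (by positivity) h2 (by linarith)
    have h4 : (x / 2) ^ (-b) = 2 ^ b * x ^ (-b) := by
      rw [Real.div_rpow hx.le (by norm_num), Real.rpow_neg (by norm_num : (0 : ℝ) ≤ 2)]
      field_simp
    have h5 : (⌊x⌋₊ : ℝ) ^ (-b) / b ≤ 2 ^ b / b * x ^ (-b) := by
      rw [h4] at h3
      rw [div_mul_eq_mul_div]
      gcongr
    have h6 : 0 ≤ C * x ^ (-b) := by positivity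
    linarith

theorem sum_rpow_neg_le_one_add_posLog {e x : ℝ} (he : 1 ≤ e) {J : Finset ℕ}
    (hJ : ∀ j ∈ J, 1 ≤ j ∧ (j : ℝ) ≤ x) : ∑ j ∈ J, (j : ℝ) ^ (-e) ≤ 1 + Real.posLog x := by
  rcases J.eq_empty_or_nonempty with rfl | ⟨i, hi⟩
  · simpa using add_nonneg zero_le_one Real.posLog_nonneg
  have hx : 1 ≤ x := le_trans (by exact_mod_cast (hJ i hi).1) (hJ i hi).2
  have hsub : J ⊆ Finset.Icc 1 ⌊x⌋₊ := fun j hj =>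
    Finset.mem_Icc.2 ⟨(hJ j hj).1, Nat.le_floor (hJ j hj).2⟩
  calc _ ≤ ∑ j ∈ J, (j : ℝ)⁻¹ := Finset.sum_le_sum fun j hj => by
          rw [← Real.rpow_neg_one]
          exact Real.rpow_le_rpow_of_exponent_le (by exact_mod_cast (hJ j hj).1) (by linarith)
    _ ≤ ∑ j ∈ Finset.Icc 1 ⌊x⌋₊, (j : ℝ)⁻¹ :=
        Finset.sum_le_sum_of_subset_of_nonneg hsub fun _ _ _ => by positivity
    _ = (harmonic ⌊x⌋₊ : ℝ) := by rw [harmonic_eq_sum_Icc]; push_cast; rfl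
    _ ≤ 1 + Real.log x := harmonic_floor_le_one_add_log x hx
    _ = _ := by rw [Real.posLog_eq_log_max_one (by linarith), max_eq_right hx]

/-! ### Weights on hyperbolic crosses -/

/-- The `ℓ_{1/θ}` norm of the weight `k^A j^B` over the cross `k j^γ ≤ n` has the order
`n^{A+θ}`, with an additional factor `(log n)^θ` at most when `A = B`. -/
theorem exists_finNormLE_inside {A B θ γ : ℝ} (hθ : 0 ≤ θ) (hB : 0 ≤ B) (hBA : B ≤ A)
    (hγ : 1 ≤ γ) : ∃ C : ℝ, 1 ≤ C ∧ ∀ n : ℝ, 0 < n → ∀ S : Finset (ℕ × ℕ),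
      (∀ q ∈ S, 1 ≤ q.1 ∧ 1 ≤ q.2 ∧ (q.1 : ℝ) * (q.2 : ℝ) ^ γ ≤ n) →
      FinNormLE θ S (fun q => (q.1 : ℝ) ^ A * (q.2 : ℝ) ^ B)
        (n ^ (A + θ) * (C * (1 + Real.posLog n)) ^ θ) ∧
      (B < A → FinNormLE θ S (fun q => (q.1 : ℝ) ^ A * (q.2 : ℝ) ^ B) (n ^ (A + θ) * C ^ θ)) := by
  have hA : 0 ≤ A := hB.trans hBA
  rcases hθ.eq_or_lt with rfl | hθ
  · refine ⟨1, le_rfl, fun n hn S hS => ?_⟩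
    have key : FinNormLE 0 S (fun q => (q.1 : ℝ) ^ A * (q.2 : ℝ) ^ B) (n ^ A) := by
      refine ⟨fun _ q hq => ?_, fun h => absurd h (lt_irrefl _)⟩
      obtain ⟨h1, h2, h3⟩ := hS q hq
      have h2' : (1 : ℝ) ≤ q.2 := by exact_mod_cast h2
      calc (q.1 : ℝ) ^ A * (q.2 : ℝ) ^ B ≤ (q.1 : ℝ) ^ A * ((q.2 : ℝ) ^ γ) ^ A := by
            rw [← Real.rpow_mul (by positivity)]
            gcongr
            nlinarith
        _ = ((q.1 : ℝ) * (q.2 : ℝ) ^ γ) ^ A := by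
            rw [Real.mul_rpow (by positivity) (by positivity)]
        _ ≤ _ := by gcongr
    simpa using And.intro key fun _ : B < A => key
  -- summation over `k` leaves the sum of `j ^ (-e)` with `e = γ (A/θ + 1) - B/θ ≥ 1`
  set e := γ * (A / θ + 1) - B / θ with he
  have hAB : B / θ ≤ A / θ := by gcongr
  have hAθ : 0 ≤ A / θ := by positivity
  have hmul : A / θ + 1 ≤ γ * (A / θ + 1) := by nlinarith
  have he1 : 1 ≤ e := by rw [he]; linarith
  obtain ⟨C, hC, hCs⟩ : ∃ C : ℝ, 0 < C ∧ (B < A → ∀ J : Finset ℕ, (∀ j ∈ J, 1 ≤ j) →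
      ∑ j ∈ J, (j : ℝ) ^ (-e) ≤ C) := by
    by_cases h : B < A
    · have : B / θ < A / θ := by gcongr
      have he2 : 0 < e - 1 := by rw [he]; linarith
      obtain ⟨C, hC, h'⟩ := exists_sum_rpow_neg_le he2
      refine ⟨C, hC, fun _ => ?_⟩
      simpa using h'
    · exact ⟨1, one_pos, fun h' => absurd h' h⟩
  refine ⟨max 1 C, le_max_left _ _, fun n hn S hS => ?_⟩
  have hsum : ∑ q ∈ S, (q.1 : ℝ) ^ (A / θ) * (q.2 : ℝ) ^ (B / θ) ≤
      n ^ ((A + θ) / θ) * ∑ j ∈ S.image Prod.snd, (j : ℝ) ^ (-e) := by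
    rw [Finset.mul_sum]
    refine sum_le_sum_of_fiber_le S _ _ fun j hj T hT => ?_
    obtain ⟨q, hq, rfl⟩ := Finset.mem_image.1 hj
    have hj0 : (0 : ℝ) < q.2 := by exact_mod_cast (hS q hq).2.1
    have hjγ : 0 < (q.2 : ℝ) ^ γ := by positivity
    simp only
    rw [← Finset.sum_mul]
    have h1 := sum_rpow_le_of_le hAθ (T := T) (x := n / (q.2 : ℝ) ^ γ) (by positivity)
      fun k hk => ⟨(hS _ (hT k hk)).1, by
        rw [le_div_iff₀ hjγ]; exact (hS _ (hT k hk)).2.2⟩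
    calc _ ≤ (n / (q.2 : ℝ) ^ γ) ^ (A / θ + 1) * (q.2 : ℝ) ^ (B / θ) := by gcongr
      _ = _ := by
        rw [Real.div_rpow hn.le hjγ.le, ← Real.rpow_mul hj0.le, he, neg_sub, Real.rpow_sub hj0,
          add_div, div_self hθ.ne']
        ring
  have hJ : ∀ j ∈ S.image Prod.snd, 1 ≤ j ∧ (j : ℝ) ≤ n := fun j hj => by
    obtain ⟨q, hq, rfl⟩ := Finset.mem_image.1 hj
    obtain ⟨h1, h2, h3⟩ := hS q hq
    have h1' : (1 : ℝ) ≤ q.1 := by exact_mod_cast h1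
    have h2' : (1 : ℝ) ≤ q.2 := by exact_mod_cast h2
    have h4 := Real.self_le_rpow_of_one_le h2' hγ
    exact ⟨h2, by nlinarith⟩
  have hl := Real.posLog_nonneg (x := n)
  constructor
  · refine finNormLE_monomial_of_sum_le hθ hn (by positivity) (hsum.trans ?_)
    gcongr
    refine (sum_rpow_neg_le_one_add_posLog he1 hJ).trans ?_
    exact le_mul_of_one_le_left (by positivity) (le_max_left _ _)
  · intro h
    refine finNormLE_monomial_of_sum_le hθ hn (by positivity) (hsum.trans ?_)
    gcongr
    exact (hCs h _ fun j hj => (hJ j hj).1).trans (le_max_right _ _)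

/-- The `ℓ_{1/θ}` norm of the weight `k^{-α} j^{-β}` outside the cross `k j^γ ≤ n` has the order
`n^{-(α-θ)}`, with an additional factor `(log n)^θ` at most for the critical value
`γ = (β - θ) / (α - θ)`. -/
theorem exists_finNormLE_outside {α β θ γ : ℝ} (hθ : 0 ≤ θ) (hα : θ < α)
    (hγ : 1 ≤ γ) (hcrit : γ * (α - θ) ≤ β - θ) : ∃ C : ℝ, 1 ≤ C ∧ ∀ n : ℝ, 0 < n →
      ∀ S : Finset (ℕ × ℕ),
      (∀ q ∈ S, 1 ≤ q.1 ∧ 1 ≤ q.2 ∧ n < (q.1 : ℝ) * (q.2 : ℝ) ^ γ) →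
      FinNormLE θ S (fun q => (q.1 : ℝ) ^ (-α) * (q.2 : ℝ) ^ (-β))
        (n ^ (-(α - θ)) * (C * (1 + Real.posLog n)) ^ θ) ∧
      (γ * (α - θ) < β - θ → FinNormLE θ S (fun q => (q.1 : ℝ) ^ (-α) * (q.2 : ℝ) ^ (-β))
        (n ^ (-(α - θ)) * C ^ θ)) := by
  rcases hθ.eq_or_lt with rfl | hθ
  · refine ⟨1, le_rfl, fun n hn S hS => ?_⟩
    have key : FinNormLE 0 S (fun q => (q.1 : ℝ) ^ (-α) * (q.2 : ℝ) ^ (-β)) (n ^ (-α)) := by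
      refine ⟨fun _ q hq => ?_, fun h => absurd h (lt_irrefl _)⟩
      obtain ⟨h1, h2, h3⟩ := hS q hq
      have h2' : (1 : ℝ) ≤ q.2 := by exact_mod_cast h2
      calc (q.1 : ℝ) ^ (-α) * (q.2 : ℝ) ^ (-β) ≤ (q.1 : ℝ) ^ (-α) * ((q.2 : ℝ) ^ γ) ^ (-α) := by
            rw [← Real.rpow_mul (by positivity)]
            gcongr
            linarith
        _ = ((q.1 : ℝ) * (q.2 : ℝ) ^ γ) ^ (-α) := by
            rw [Real.mul_rpow (by positivity) (by positivity)]
        _ ≤ _ := Real.rpow_le_rpow_of_nonpos hn h3.le (by linarith)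
    simpa using And.intro key fun _ : γ * (α - 0) < β - 0 => key
  set a := (α - θ) / θ with ha
  have ha0 : 0 < a := div_pos (by linarith) hθ
  have haα : α / θ = a + 1 := by rw [ha]; field_simp; ring
  have hβ : γ * a ≤ β / θ - 1 := by
    rw [ha, mul_div_assoc', div_sub_one hθ.ne']; gcongr
  -- summation over `k` leaves the sum of `j ^ (-e)`
  set e := β / θ - γ * a with he
  have he1 : 1 ≤ e := by rw [he]; linarith
  have hb0 : 0 < β / θ - 1 := by nlinarith
  obtain ⟨C, hC, hCs⟩ : ∃ C : ℝ, 0 < C ∧ (γ * (α - θ) < β - θ → ∀ J : Finset ℕ,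
      (∀ j ∈ J, 1 ≤ j) → ∑ j ∈ J, (j : ℝ) ^ (-e) ≤ C) := by
    by_cases h : γ * (α - θ) < β - θ
    · have he2 : 0 < e - 1 := by
        have : γ * a < β / θ - 1 := by
          rw [ha, mul_div_assoc', div_sub_one hθ.ne']; gcongr
        rw [he]; linarith
      obtain ⟨C, hC, h'⟩ := exists_sum_rpow_neg_le he2
      refine ⟨C, hC, fun _ => ?_⟩
      simpa using h'
    · exact ⟨1, one_pos, fun h' => absurd h' h⟩
  obtain ⟨C₁, hC₁, hk⟩ := exists_sum_rpow_neg_tail_le ha0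
  obtain ⟨C₂, hC₂, hk'⟩ := exists_sum_rpow_neg_le ha0
  obtain ⟨C₃, hC₃, hj'⟩ := exists_sum_rpow_neg_tail_le hb0
  refine ⟨max 1 (C₁ * C + C₁ + C₂ * C₃), le_max_left _ _, fun n hn S hS => ?_⟩
  have hl := Real.posLog_nonneg (x := n)
  have hna : 0 < n ^ (-a) := by positivity
  have hexp : -(α - θ) / θ = -a := by rw [ha, neg_div]
  have hαe : -α / θ = -(a + 1) := by rw [← haα, neg_div]
  have hβe : -β / θ = -(β / θ) := neg_div _ _
  have hfib : ∀ (S : Finset (ℕ × ℕ)),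
      (∀ q ∈ S, 1 ≤ q.1 ∧ 1 ≤ q.2 ∧ n < (q.1 : ℝ) * (q.2 : ℝ) ^ γ) →
      ∑ q ∈ S, (q.1 : ℝ) ^ (-α / θ) * (q.2 : ℝ) ^ (-β / θ) ≤
      n ^ (-a) * (C₁ * ∑ j ∈ S.image Prod.snd, (j : ℝ) ^ (-e)) := by
    intro S hS
    rw [Finset.mul_sum, Finset.mul_sum]
    refine sum_le_sum_of_fiber_le S _ _ fun j hj T hT => ?_
    obtain ⟨q, hq, rfl⟩ := Finset.mem_image.1 hj
    have hj0 : (0 : ℝ) < q.2 := by exact_mod_cast (hS q hq).2.1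
    have hjγ : 0 < (q.2 : ℝ) ^ γ := by positivity
    simp only
    rw [← Finset.sum_mul, hαe, hβe]
    have h1 := hk (n / (q.2 : ℝ) ^ γ) (by positivity) T
      fun k hk => ⟨(hS _ (hT k hk)).1, by
        rw [div_lt_iff₀ hjγ]; exact (hS _ (hT k hk)).2.2⟩
    calc _ ≤ (C₁ * (n / (q.2 : ℝ) ^ γ) ^ (-a)) * (q.2 : ℝ) ^ (-(β / θ)) := by gcongr
      _ = _ := by
        rw [Real.div_rpow hn.le hjγ.le, ← Real.rpow_mul hj0.le, he, neg_sub,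
          sub_eq_add_neg, Real.rpow_add hj0, mul_neg, Real.rpow_neg hj0.le (γ * a)]
        field_simp
  constructor
  · refine finNormLE_monomial_of_sum_le hθ hn (by positivity) ?_
    rw [hexp]
    by_cases hs : γ * (α - θ) < β - θ
    · refine (hfib S hS).trans (mul_le_mul_of_nonneg_left ?_ hna.le)
      have h1 := hCs hs (S.image Prod.snd) fun j hj => by
        obtain ⟨q, hq, rfl⟩ := Finset.mem_image.1 hj
        exact (hS q hq).2.1
      calc _ ≤ C₁ * C := by gcongr
        _ ≤ C₁ * C + C₁ + C₂ * C₃ := by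
            have : 0 < C₂ * C₃ := by positivity
            linarith
        _ ≤ max 1 (C₁ * C + C₁ + C₂ * C₃) := le_max_right _ _
        _ ≤ _ := le_mul_of_one_le_right (by positivity) (by linarith)
    -- at the critical `γ` the rows with `j^γ > n`, which the cross misses entirely, are
    -- estimated by a tail of `∑ j^{-β/θ}`
    have hγa : γ * a = β / θ - 1 := by
      have : γ * (α - θ) = β - θ := le_antisymm hcrit (not_lt.1 hs)
      rw [ha, mul_div_assoc', this]; field_simp
    rw [← Finset.sum_filter_add_sum_filter_not S (fun q => (q.2 : ℝ) ^ γ ≤ n)]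
    have hlow : ∑ q ∈ S with (q.2 : ℝ) ^ γ ≤ n, (q.1 : ℝ) ^ (-α / θ) * (q.2 : ℝ) ^ (-β / θ) ≤
        n ^ (-a) * (C₁ * (1 + Real.posLog n)) := by
      refine (hfib _ fun q hq => hS q (Finset.mem_filter.1 hq).1).trans ?_
      gcongr
      refine sum_rpow_neg_le_one_add_posLog he1 fun j hj => ?_
      obtain ⟨q, hq, rfl⟩ := Finset.mem_image.1 hj
      have hq' := Finset.mem_filter.1 hq
      have h2 := (hS q hq'.1).2.1
      exact ⟨h2, (Real.self_le_rpow_of_one_le (by exact_mod_cast h2) hγ).trans hq'.2⟩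
    have hhigh : ∑ q ∈ S with ¬ (q.2 : ℝ) ^ γ ≤ n,
        (q.1 : ℝ) ^ (-α / θ) * (q.2 : ℝ) ^ (-β / θ) ≤ n ^ (-a) * (C₂ * C₃) := by
      set S' := S.filter fun q => ¬ (q.2 : ℝ) ^ γ ≤ n
      have h1 : ∑ q ∈ S', (q.1 : ℝ) ^ (-α / θ) * (q.2 : ℝ) ^ (-β / θ) ≤
          ∑ j ∈ S'.image Prod.snd, C₂ * (j : ℝ) ^ (-β / θ) := by
        refine sum_le_sum_of_fiber_le S' _ _ fun j hj T hT => ?_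
        simp only
        rw [← Finset.sum_mul, hαe]
        gcongr
        exact hk' T fun k hk => (hS _ (Finset.mem_filter.1 (hT k hk)).1).1
      refine h1.trans ?_
      rw [← Finset.mul_sum]
      have h2 := hj' (n ^ (1 / γ)) (by positivity) (S'.image Prod.snd) fun j hj => by
        obtain ⟨q, hq, rfl⟩ := Finset.mem_image.1 hj
        have hq' := Finset.mem_filter.1 hq
        refine ⟨(hS q hq'.1).2.1, ?_⟩
        rw [one_div, Real.rpow_inv_lt_iff_of_pos hn.le (by positivity) (by linarith)]
        exact not_le.1 hq'.2
      rw [sub_add_cancel, ← Real.rpow_mul hn.le, ← hγa] at h2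
      rw [hβe]
      have h3 : 1 / γ * -(γ * a) = -a := by field_simp
      rw [h3] at h2
      calc _ ≤ C₂ * (C₃ * n ^ (-a)) := by gcongr
        _ = _ := by ring
    calc _ ≤ n ^ (-a) * (C₁ * (1 + Real.posLog n)) + n ^ (-a) * (C₂ * C₃) := add_le_add hlow hhigh
      _ = n ^ (-a) * (C₁ * (1 + Real.posLog n) + C₂ * C₃) := by ring
      _ ≤ n ^ (-a) * ((C₁ * C + C₁ + C₂ * C₃) * (1 + Real.posLog n)) := by
          gcongr
          have h1 : 0 ≤ C₁ * C * (1 + Real.posLog n) := by positivity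
          have h2 : 0 ≤ C₂ * C₃ * Real.posLog n := by positivity
          linarith
      _ ≤ _ := by
          gcongr
          exact le_max_right _ _
  · intro h
    refine finNormLE_monomial_of_sum_le hθ hn (by positivity) ?_
    rw [hexp]
    refine (hfib S hS).trans (mul_le_mul_of_nonneg_left ?_ hna.le)
    have h1 := hCs h (S.image Prod.snd) fun j hj => by
      obtain ⟨q, hq, rfl⟩ := Finset.mem_image.1 hj
      exact (hS q hq).2.1
    calc _ ≤ C₁ * C := by gcongr
      _ ≤ C₁ * C + C₁ + C₂ * C₃ := by
          have : 0 < C₂ * C₃ := by positivity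
          linarith
      _ ≤ _ := le_max_right _ _

/-! ### Data error and truncation error -/

theorem mem_hyperbolicCross {r₁ r₂ : ℕ} (hr₁ : 1 ≤ r₁) (hr₂ : 1 ≤ r₂) {n γ : ℝ} (hn : 0 < n)
    (hγ : 0 < γ) (q : ℕ × ℕ) :
    q ∈ hyperbolicCross r₁ r₂ n γ ↔
      r₁ ≤ q.1 ∧ r₂ ≤ q.2 ∧ (q.1 : ℝ) * (q.2 : ℝ) ^ γ ≤ n := by
  simp only [hyperbolicCross, Finset.mem_filter, Finset.mem_product, Finset.mem_Icc]
  refine ⟨fun h => ⟨h.1.1.1, h.1.2.1, h.2⟩, fun ⟨h1, h2, h3⟩ => ⟨⟨⟨h1, ?_⟩, ⟨h2, ?_⟩⟩, h3⟩⟩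
  · have hr : (0 : ℝ) < r₂ := by exact_mod_cast hr₂
    refine Nat.le_floor ?_
    rw [le_div_iff₀ (by positivity)]
    refine le_trans ?_ h3
    gcongr
  · have hr : (0 : ℝ) < r₁ := by exact_mod_cast hr₁
    refine Nat.le_floor ?_
    rw [one_div, Real.le_rpow_inv_iff_of_pos (by positivity) (by positivity) hγ,
      le_div_iff₀ hr, mul_comm]
    refine le_trans ?_ h3
    gcongr

theorem finNormLE_noise {p : ℝ≥0∞} (hp : 1 ≤ p) {ι : Type*} {ξ : lp (fun _ : ι => ℝ) p} {δ : ℝ}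
    (hξ : ‖ξ‖ ≤ δ) (S : Finset ι) :
    FinNormLE (p⁻¹).toReal S (fun q => |ξ q|) δ := by
  have hp0 : p ≠ 0 := (zero_lt_one.trans_le hp).ne'
  refine ⟨fun _ q _ => (lp.norm_apply_le_norm hp0 ξ q).trans hξ, fun h => ?_⟩
  rw [ENNReal.toReal_inv, one_div, inv_inv]
  rw [ENNReal.toReal_inv, inv_pos] at h
  refine (lp.sum_rpow_le_norm_rpow h ξ S).trans ?_
  exact Real.rpow_le_rpow (lp.norm_nonneg' ξ) hξ h.le

theorem finNormLE_smooth {s μ R : ℝ} (hs : 1 ≤ s) {f : ℝ × ℝ → ℝ}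
    (hf : f ∈ smoothSpace s μ) (hR : smoothNorm s μ f ≤ R) {S : Finset (ℕ × ℕ)}
    (hS : ∀ q ∈ S, 1 ≤ q.1 ∧ 1 ≤ q.2) :
    FinNormLE (1 / s) S (fun q => ((q.1 : ℝ) ^ μ * (q.2 : ℝ) ^ μ) * |coeff f q|) R := by
  have hs0 : 0 < s := by linarith
  refine ⟨fun h => absurd h (by positivity), fun _ => ?_⟩
  rw [one_div_one_div]
  have h0 : ∀ q, 0 ≤ smoothTerm s μ f q := fun q => by unfold smoothTerm; positivity
  have ht : 0 ≤ ∑' q, smoothTerm s μ f q := tsum_nonneg h0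
  have h1 : ∑' q, smoothTerm s μ f q ≤ R ^ s := by
    have := Real.rpow_le_rpow (by unfold smoothNorm; positivity) hR hs0.le
    rwa [smoothNorm, ← Real.rpow_mul ht, one_div_mul_cancel hs0.ne', Real.rpow_one] at this
  refine le_trans (le_of_eq ?_) ((hf.2.sum_le_tsum S fun q _ => h0 q).trans h1)
  refine Finset.sum_congr rfl fun q hq => ?_
  have h2 : (1 : ℝ) ≤ (q.1 : ℝ) * (q.2 : ℝ) := by
    exact_mod_cast Nat.mul_pos (hS q hq).1 (hS q hq).2
  rw [smoothTerm, max_eq_right h2, Real.mul_rpow (by positivity) (abs_nonneg _),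
    ← Real.mul_rpow (Nat.cast_nonneg _) (Nat.cast_nonneg _), ← Real.rpow_mul (by positivity),
    mul_comm μ s]

/-- A choice of logarithmic factor: `1` is admitted when the strict inequality `P` holds, and
`1 + log⁺ n` always. -/
def IsLogFactor (P : Prop) (n L : ℝ) : Prop := (P ∧ L = 1) ∨ L = 1 + Real.posLog n

theorem IsLogFactor.pos {P : Prop} {n L : ℝ} (h : IsLogFactor P n L) : 0 < L := by
  have := Real.posLog_nonneg (x := n)
  rcases h with ⟨_, rfl⟩ | rfl
  · exact one_pos
  · linarith

theorem exists_sum_norm_outside_le {s μ : ℝ} {r₁ r₂ : ℕ} (hs : 1 ≤ s) {E γ : ℝ} (hE0 : 0 < E)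
    (hE : E = μ - 2 * r₁ + 1 / s - 3 / 2) (hγ : 1 ≤ γ)
    (hcrit : γ * E ≤ E + 2 * ((r₁ : ℝ) - r₂)) :
    ∃ C : ℝ, 1 ≤ C ∧ ∀ n : ℝ, 0 < n → ∀ L : ℝ,
      IsLogFactor (γ * E < E + 2 * ((r₁ : ℝ) - r₂)) n L →
      ∀ R : ℝ, ∀ f ∈ smoothSpace s μ, smoothNorm s μ f ≤ R → ∀ S : Finset (ℕ × ℕ),
      (∀ q ∈ S, 1 ≤ q.1 ∧ 1 ≤ q.2 ∧ n < (q.1 : ℝ) * (q.2 : ℝ) ^ γ) →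
      ∑ q ∈ S, ‖coeff f q • phiDeriv r₁ r₂ q‖ ≤
        4 * (R * (n ^ (-E) * (C * L) ^ (1 - 1 / s))) := by
  have hs1 : 1 / s ≤ 1 := by rw [div_le_one (by linarith)]; exact hs
  have hs0 : 0 < 1 / s := by positivity
  have e1 : (μ - (2 * (r₁ : ℝ) + 1 / 2)) - (1 - 1 / s) = E := by rw [hE]; ring
  have e2 : (μ - (2 * (r₂ : ℝ) + 1 / 2)) - (1 - 1 / s) = E + 2 * ((r₁ : ℝ) - r₂) := by
    rw [hE]; ring
  obtain ⟨C, hC, h⟩ := exists_finNormLE_outside (α := μ - (2 * (r₁ : ℝ) + 1 / 2))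
    (β := μ - (2 * (r₂ : ℝ) + 1 / 2)) (θ := 1 - 1 / s) (γ := γ) (by linarith) (by linarith)
    hγ (by rw [e1, e2]; exact hcrit)
  rw [e1, e2] at h
  refine ⟨C, hC, fun n hn L hL R f hf hR S hS => ?_⟩
  have hLpos := hL.pos
  have hK : FinNormLE (1 - 1 / s) S (fun q => (q.1 : ℝ) ^ (-(μ - (2 * (r₁ : ℝ) + 1 / 2))) *
      (q.2 : ℝ) ^ (-(μ - (2 * (r₂ : ℝ) + 1 / 2)))) (n ^ (-E) * (C * L) ^ (1 - 1 / s)) := by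
    rcases hL with ⟨hP, rfl⟩ | rfl
    · rw [mul_one]; exact (h n hn S hS).2 hP
    · exact (h n hn S hS).1
  have hR0 : 0 ≤ R := le_trans (by
    unfold smoothNorm
    exact Real.rpow_nonneg (tsum_nonneg fun q => by unfold smoothTerm; positivity) _) hR
  have hsm := finNormLE_smooth hs hf hR fun q hq => ⟨(hS q hq).1, (hS q hq).2.1⟩
  have key := FinNormLE.sum_mul_le (θ := 1 - 1 / s) (by linarith) (by linarith)
    (x := fun q => ((q.1 : ℝ) ^ μ * (q.2 : ℝ) ^ μ) * |coeff f q|)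
    (fun q _ => by positivity) (fun q _ => by positivity) hR0 (by positivity)
    (by rw [sub_sub_cancel]; exact hsm) hK
  refine le_trans ?_ (mul_le_mul_of_nonneg_left key (by norm_num))
  rw [Finset.mul_sum]
  refine Finset.sum_le_sum fun q hq => ?_
  obtain ⟨h1, h2, _⟩ := hS q hq
  have h1' : (0 : ℝ) < q.1 := by exact_mod_cast h1
  have h2' : (0 : ℝ) < q.2 := by exact_mod_cast h2
  rw [norm_smul, Real.norm_eq_abs]
  refine (mul_le_mul_of_nonneg_left (norm_phiDeriv_le r₁ r₂ h1 h2) (abs_nonneg _)).trans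
    (le_of_eq ?_)
  have w1 : (q.1 : ℝ) ^ (2 * (r₁ : ℝ) + 1 / 2) =
      (q.1 : ℝ) ^ μ * (q.1 : ℝ) ^ (-(μ - (2 * (r₁ : ℝ) + 1 / 2))) := by
    rw [← Real.rpow_add h1']; congr 1; ring
  have w2 : (q.2 : ℝ) ^ (2 * (r₂ : ℝ) + 1 / 2) =
      (q.2 : ℝ) ^ μ * (q.2 : ℝ) ^ (-(μ - (2 * (r₂ : ℝ) + 1 / 2))) := by
    rw [← Real.rpow_add h2']; congr 1; ring
  rw [w1, w2]
  ring

theorem exists_sum_norm_inside_le {p : ℝ≥0∞} {r₁ r₂ : ℕ} (hp : 1 ≤ p) (hr : r₂ ≤ r₁) {γ : ℝ}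
    (hγ : 1 ≤ γ) :
    ∃ C : ℝ, 1 ≤ C ∧ ∀ n : ℝ, 0 < n → ∀ L : ℝ, IsLogFactor (r₂ < r₁) n L →
      ∀ δ : ℝ, 0 ≤ δ → ∀ ξ : lp (fun _ : ℕ × ℕ => ℝ) p, ‖ξ‖ ≤ δ → ∀ S : Finset (ℕ × ℕ),
      (∀ q ∈ S, 1 ≤ q.1 ∧ 1 ≤ q.2 ∧ (q.1 : ℝ) * (q.2 : ℝ) ^ γ ≤ n) →
      ∑ q ∈ S, ‖ξ q • phiDeriv r₁ r₂ q‖ ≤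
        4 * (δ * (n ^ (2 * (r₁ : ℝ) + 1 / 2 + (1 - (p⁻¹).toReal)) *
          (C * L) ^ (1 - (p⁻¹).toReal))) := by
  have hp1 : (p⁻¹).toReal ≤ 1 := by
    refine ENNReal.toReal_le_of_le_ofReal zero_le_one ?_
    simpa using hp
  have hp0 : 0 ≤ (p⁻¹).toReal := ENNReal.toReal_nonneg
  have hr' : (r₂ : ℝ) ≤ r₁ := by exact_mod_cast hr
  obtain ⟨C, hC, h⟩ := exists_finNormLE_inside (A := 2 * (r₁ : ℝ) + 1 / 2)
    (B := 2 * (r₂ : ℝ) + 1 / 2) (θ := 1 - (p⁻¹).toReal) (γ := γ) (by linarith) (by positivity)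
    (by linarith) hγ
  refine ⟨C, hC, fun n hn L hL δ hδ ξ hξ S hS => ?_⟩
  have hLpos := hL.pos
  have hK : FinNormLE (1 - (p⁻¹).toReal) S (fun q => (q.1 : ℝ) ^ (2 * (r₁ : ℝ) + 1 / 2) *
      (q.2 : ℝ) ^ (2 * (r₂ : ℝ) + 1 / 2))
      (n ^ (2 * (r₁ : ℝ) + 1 / 2 + (1 - (p⁻¹).toReal)) * (C * L) ^ (1 - (p⁻¹).toReal)) := by
    rcases hL with ⟨hP, rfl⟩ | rfl
    · rw [mul_one]
      have : (r₂ : ℝ) < r₁ := by exact_mod_cast hP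
      exact (h n hn S hS).2 (by linarith)
    · exact (h n hn S hS).1
  have key := FinNormLE.sum_mul_le (θ := 1 - (p⁻¹).toReal) (by linarith) (by linarith)
    (fun q _ => abs_nonneg _) (fun q _ => by positivity) hδ (by positivity)
    (by rw [sub_sub_cancel]; exact finNormLE_noise hp hξ S) hK
  refine le_trans ?_ (mul_le_mul_of_nonneg_left key (by norm_num))
  rw [Finset.mul_sum]
  refine Finset.sum_le_sum fun q hq => ?_
  rw [norm_smul, Real.norm_eq_abs]
  refine (mul_le_mul_of_nonneg_left (norm_phiDeriv_le r₁ r₂ (hS q hq).1 (hS q hq).2.1)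
    (abs_nonneg _)).trans (le_of_eq ?_)
  ring

theorem one_le_of_mem_Ici {r₁ r₂ : ℕ} (hr₁ : 1 ≤ r₁) (hr₂ : 1 ≤ r₂) {q : ℕ × ℕ}
    (hq : q ∈ Ici (r₁, r₂)) : 1 ≤ q.1 ∧ 1 ≤ q.2 :=
  ⟨hr₁.trans hq.1, hr₂.trans hq.2⟩

theorem summable_derivTerm {s μ : ℝ} {r₁ r₂ : ℕ} (hs : 1 ≤ s) (hr₂ : 1 ≤ r₂) (hr : r₂ ≤ r₁)
    (hμ : 2 * r₁ - 1 / s + 3 / 2 < μ) {f : ℝ × ℝ → ℝ} (hf : f ∈ smoothSpace s μ) :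
    Summable (derivTerm r₁ r₂ f) := by
  have hr' : (r₂ : ℝ) ≤ r₁ := by exact_mod_cast hr
  obtain ⟨C, hC, h⟩ := exists_sum_norm_outside_le (r₂ := r₂) (γ := 1) hs (by linarith)
    (rfl : μ - 2 * r₁ + 1 / s - 3 / 2 = _) le_rfl (by linarith)
  -- all index pairs lie outside the cross with `n = 1/2`
  refine Summable.of_norm (summable_of_sum_le (c := 4 * (smoothNorm s μ f *
    ((1 / 2) ^ (-(μ - 2 * r₁ + 1 / s - 3 / 2)) *
      (C * (1 + Real.posLog (1 / 2))) ^ (1 - 1 / s)))) (fun _ => norm_nonneg _) fun T => ?_)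
  change ∑ q ∈ T, ‖coeff f q • phiDeriv r₁ r₂ q‖ ≤ _
  refine le_trans (le_of_eq ?_) (h (1 / 2) (by norm_num) _ (Or.inr rfl) _ f hf le_rfl
    (T.map (Function.Embedding.subtype _)) fun q hq => ?_)
  · exact (Finset.sum_map T (Function.Embedding.subtype _)
      (fun q => ‖coeff f q • phiDeriv r₁ r₂ q‖)).symm
  obtain ⟨q, _, rfl⟩ := Finset.mem_map.1 hq
  obtain ⟨h1, h2⟩ := one_le_of_mem_Ici (hr₂.trans hr) hr₂ q.2
  refine ⟨h1, h2, ?_⟩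
  have : (1 : ℝ) ≤ (q.1.1 : ℝ) * (q.1.2 : ℝ) := by exact_mod_cast Nat.mul_pos h1 h2
  rw [Real.rpow_one]
  exact lt_of_lt_of_le (by norm_num) this

/-- The error of the truncation method splits into a truncation error of order `n^{-E}` and a data
error of order `δ n^{M-E}`, up to powers of `log n`. -/
theorem exists_norm_mixedDeriv_sub_truncation_le {s μ : ℝ} {p : ℝ≥0∞} {r₁ r₂ : ℕ} (hs : 1 ≤ s)
    (hp : 1 ≤ p) (hr₂ : 1 ≤ r₂) (hr : r₂ ≤ r₁) {ip M E γ : ℝ} (hip : ip = (p⁻¹).toReal)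
    (hM : M = μ - ip + 1 / s) (hE : E = μ - 2 * r₁ + 1 / s - 3 / 2) (hE0 : 0 < E)
    (hγ : 1 ≤ γ) (hcrit : γ * E ≤ E + 2 * ((r₁ : ℝ) - r₂)) :
    ∃ C : ℝ, 1 ≤ C ∧ ∀ n : ℝ, 0 < n → ∀ L₁ L₂ : ℝ,
      IsLogFactor (γ * E < E + 2 * ((r₁ : ℝ) - r₂)) n L₁ → IsLogFactor (r₂ < r₁) n L₂ →
      ∀ R : ℝ, ∀ f ∈ smoothSpace s μ, smoothNorm s μ f ≤ R →
      ∀ δ : ℝ, 0 ≤ δ → ∀ y : ℕ × ℕ → ℝ, IsPerturbation p δ f y →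
      ‖mixedDeriv r₁ r₂ f - truncation r₁ r₂ n γ y‖ ≤
        C * (R * n ^ (-E) * L₁ ^ (1 - 1 / s) + δ * n ^ (M - E) * L₂ ^ (1 - ip)) := by
  obtain ⟨C₁, hC₁, h₁⟩ := exists_sum_norm_outside_le (r₂ := r₂) hs hE0 hE hγ hcrit
  obtain ⟨C₂, hC₂, h₂⟩ := exists_sum_norm_inside_le (p := p) hp hr hγ
  have hC₁' : 1 ≤ C₁ ^ (1 - 1 / s) := Real.one_le_rpow hC₁ (by
    rw [sub_nonneg, div_le_one (by linarith)]; exact hs)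
  refine ⟨4 * (C₁ ^ (1 - 1 / s) + C₂ ^ (1 - ip)), ?_, ?_⟩
  · have : 0 ≤ C₂ ^ (1 - ip) := by positivity
    linarith
  intro n hn L₁ L₂ hL₁ hL₂ R f hf hR δ hδ y ⟨ξ, hξ, hξδ⟩
  have hr₁ : 1 ≤ r₁ := hr₂.trans hr
  have hγ0 : 0 < γ := by linarith
  have hμ : 2 * r₁ - 1 / s + 3 / 2 < μ := by linarith
  have hsum := (summable_derivTerm hs hr₂ hr hμ hf).hasSum
  set Γ := hyperbolicCross r₁ r₂ n γ
  classical
  set S₀ : Finset (Ici (r₁, r₂)) := Γ.subtype (· ∈ Ici (r₁, r₂)) with hS₀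
  have hmem : ∀ q ∈ Γ, q ∈ Ici (r₁, r₂) := fun q hq => by
    obtain ⟨h1, h2, _⟩ := (mem_hyperbolicCross hr₁ hr₂ hn hγ0 q).1 hq
    exact ⟨h1, h2⟩
  have hpos₁ := hL₁.pos
  have hpos₂ := hL₂.pos
  -- the bound for all partial sums that contain the cross passes to the limit
  have hlim := (hsum.sub_const (truncation r₁ r₂ n γ y)).norm
  refine le_of_tendsto hlim ?_
  filter_upwards [Filter.eventually_ge_atTop S₀] with T hT
  have hdata : ∑ q ∈ S₀, derivTerm r₁ r₂ f q - truncation r₁ r₂ n γ y =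
      ∑ q ∈ Γ, ξ q • phiDeriv r₁ r₂ q := by
    have : ∑ q ∈ S₀, derivTerm r₁ r₂ f q = ∑ q ∈ Γ, coeff f q • phiDeriv r₁ r₂ q :=
      Finset.sum_subtype_of_mem (fun q => coeff f q • phiDeriv r₁ r₂ q) hmem
    rw [this, truncation, ← Finset.sum_sub_distrib]
    exact Finset.sum_congr rfl fun q _ => by rw [hξ, sub_smul]
  have hin : ‖∑ q ∈ Γ, ξ q • phiDeriv r₁ r₂ q‖ ≤
      4 * (δ * (n ^ (M - E) * (C₂ * L₂) ^ (1 - ip))) := by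
    have e : M - E = 2 * (r₁ : ℝ) + 1 / 2 + (1 - (p⁻¹).toReal) := by rw [hM, hE, hip]; ring
    rw [e, hip]
    refine (norm_sum_le _ _).trans (h₂ n hn L₂ hL₂ δ hδ ξ hξδ Γ fun q hq => ?_)
    obtain ⟨h1, h2, h3⟩ := (mem_hyperbolicCross hr₁ hr₂ hn hγ0 q).1 hq
    exact ⟨hr₁.trans h1, hr₂.trans h2, h3⟩
  have hout : ‖∑ q ∈ T \ S₀, derivTerm r₁ r₂ f q‖ ≤
      4 * (R * (n ^ (-E) * (C₁ * L₁) ^ (1 - 1 / s))) := by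
    refine (norm_sum_le _ _).trans ?_
    refine le_trans (le_of_eq (Finset.sum_map (T \ S₀) (Function.Embedding.subtype _)
      (fun q => ‖coeff f q • phiDeriv r₁ r₂ q‖)).symm) ?_
    refine h₁ n hn L₁ hL₁ R f hf hR _ fun q hq => ?_
    obtain ⟨q, hqT, rfl⟩ := Finset.mem_map.1 hq
    obtain ⟨h1, h2⟩ := one_le_of_mem_Ici hr₁ hr₂ q.2
    refine ⟨h1, h2, not_le.1 fun hle => (Finset.mem_sdiff.1 hqT).2 ?_⟩
    rw [hS₀, Finset.mem_subtype]
    exact (mem_hyperbolicCross hr₁ hr₂ hn hγ0 q.1).2 ⟨q.2.1, q.2.2, hle⟩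
  have hsplit : ∑ q ∈ T, derivTerm r₁ r₂ f q - truncation r₁ r₂ n γ y =
      ∑ q ∈ T \ S₀, derivTerm r₁ r₂ f q + ∑ q ∈ Γ, ξ q • phiDeriv r₁ r₂ q := by
    rw [← hdata, ← Finset.sum_sdiff hT]; abel
  rw [hsplit]
  refine (norm_add_le _ _).trans ((add_le_add hout hin).trans ?_)
  rw [Real.mul_rpow (by linarith) hpos₁.le, Real.mul_rpow (by linarith) hpos₂.le]
  have hR0 : 0 ≤ R := le_trans (by
    unfold smoothNorm
    exact Real.rpow_nonneg (tsum_nonneg fun q => by unfold smoothTerm; positivity) _) hR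
  set a := R * n ^ (-E) * L₁ ^ (1 - 1 / s) with ha
  set b := δ * n ^ (M - E) * L₂ ^ (1 - ip) with hb
  have ha0 : 0 ≤ a := by positivity
  have hb0 : 0 ≤ b := by positivity
  have hc2 : 0 ≤ C₂ ^ (1 - ip) := by positivity
  calc _ = 4 * (C₁ ^ (1 - 1 / s) * a + C₂ ^ (1 - ip) * b) := by rw [ha, hb]; ring
    _ ≤ 4 * (C₁ ^ (1 - 1 / s) * a + C₂ ^ (1 - ip) * b) +
        4 * (C₂ ^ (1 - ip) * a + C₁ ^ (1 - 1 / s) * b) :=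
          le_add_of_nonneg_right (by positivity)
    _ = _ := by ring

/-! ### Choice of the truncation parameter -/

/-- The standing assumptions on the parameters, with `M` and `E` the exponents that occur in the
error bounds. -/
structure IsSetting (s μ : ℝ) (p : ℝ≥0∞) (r₁ r₂ : ℕ) (ip M E : ℝ) : Prop where
  hs : 1 ≤ s
  hp : 1 ≤ p
  hr₂ : 1 ≤ r₂
  hr : r₂ ≤ r₁
  hip : ip = (p⁻¹).toReal
  hM : M = μ - ip + 1 / s
  hE : E = μ - 2 * r₁ + 1 / s - 3 / 2
  hE0 : 0 < E

namespace IsSetting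

variable {s μ : ℝ} {p : ℝ≥0∞} {r₁ r₂ : ℕ} {ip M E : ℝ}

theorem ip_le_one (h : IsSetting s μ p r₁ r₂ ip M E) : ip ≤ 1 := by
  rw [h.hip]
  exact ENNReal.toReal_le_of_le_ofReal zero_le_one (by simpa using h.hp)

theorem E_le_M (h : IsSetting s μ p r₁ r₂ ip M E) : E ≤ M := by
  have := h.ip_le_one
  have h1 : (0 : ℝ) ≤ r₁ := by positivity
  rw [h.hE, h.hM]
  linarith

theorem M_pos (h : IsSetting s μ p r₁ r₂ ip M E) : 0 < M := h.hE0.trans_le h.E_le_M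

theorem one_div_s_le (h : IsSetting s μ p r₁ r₂ ip M E) : 1 / s ≤ 1 := by
  rw [div_le_one (zero_lt_one.trans_le h.hs)]; exact h.hs

theorem one_div_s_pos (h : IsSetting s μ p r₁ r₂ ip M E) : 0 < 1 / s :=
  one_div_pos.2 (zero_lt_one.trans_le h.hs)

end IsSetting

theorem UniformErrorBound.congr {s μ : ℝ} {p : ℝ≥0∞} {r₁ r₂ : ℕ} {γ : ℝ} {Δ : Set ℝ}
    {N ε N' ε' : ℝ → ℝ} (h : UniformErrorBound s μ p r₁ r₂ γ Δ N ε) (hN : ∀ δ ∈ Δ, N' δ = N δ)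
    (hε : ∀ δ ∈ Δ, ε' δ = ε δ) : UniformErrorBound s μ p r₁ r₂ γ Δ N' ε' := by
  intro a b R ha hb hR
  obtain ⟨c, hc, H⟩ := h a b R ha hb hR
  refine ⟨c, hc, fun δ hδ n h1 h2 => ?_⟩
  rw [hN δ hδ] at h1 h2
  rw [hε δ hδ]
  exact H δ hδ n h1 h2

/-- With `n ≍ D^{-1/M}`, `D = δ / Λ`, the truncation error `n^{-E}` and the data error
`δ n^{M-E}` become `D^{E/M}` and `Λ D^{E/M}`, so that only the logarithmic factors remain to be
compared with `G`. -/
theorem uniformErrorBound_of_logFactor_le {s μ : ℝ} {p : ℝ≥0∞} {r₁ r₂ : ℕ} {ip M E γ : ℝ}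
    (h : IsSetting s μ p r₁ r₂ ip M E) (hγ : 1 ≤ γ)
    (hcrit : γ * E ≤ E + 2 * ((r₁ : ℝ) - r₂)) {Δ : Set ℝ} {Λ G : ℝ → ℝ}
    (hΔ : ∀ δ ∈ Δ, 0 < δ) (hΛ : ∀ δ ∈ Δ, 0 < Λ δ)
    (H : ∀ b : ℝ, 0 < b → ∃ c : ℝ, 0 < c ∧ ∀ δ ∈ Δ, ∀ n : ℝ, 0 < n →
      n ≤ b * (δ / Λ δ) ^ (-(1 / M)) → ∃ L₁ L₂ : ℝ,
        IsLogFactor (γ * E < E + 2 * ((r₁ : ℝ) - r₂)) n L₁ ∧ IsLogFactor (r₂ < r₁) n L₂ ∧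
        L₁ ^ (1 - 1 / s) ≤ c * G δ ∧ Λ δ * L₂ ^ (1 - ip) ≤ c * G δ) :
    UniformErrorBound s μ p r₁ r₂ γ Δ (fun δ => (δ / Λ δ) ^ (-(1 / M)))
      (fun δ => (δ / Λ δ) ^ (E / M) * G δ) := by
  intro a b R ha hb hR
  obtain ⟨c, hc, H⟩ := H b hb
  obtain ⟨C, hC, hmain⟩ := exists_norm_mixedDeriv_sub_truncation_le h.hs h.hp h.hr₂ h.hr h.hip
    h.hM h.hE h.hE0 hγ hcrit
  have hM := h.M_pos
  refine ⟨C * (R * a ^ (-E) + b ^ (M - E)) * c, by positivity, ?_⟩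
  intro δ hδ n hn1 hn2 f hf hfR y hy
  have hδ0 := hΔ δ hδ
  have hΛ0 := hΛ δ hδ
  simp only at hn1 hn2 ⊢
  set D := δ / Λ δ with hD
  have hD0 : 0 < D := by positivity
  have hN0 : 0 < D ^ (-(1 / M)) := by positivity
  have hn0 : 0 < n := lt_of_lt_of_le (by positivity) hn1
  obtain ⟨L₁, L₂, hL₁, hL₂, hG₁, hG₂⟩ := H δ hδ n hn0 hn2
  have hpos₁ := hL₁.pos
  have hpos₂ := hL₂.pos
  refine (hmain n hn0 L₁ L₂ hL₁ hL₂ R f hf hfR δ hδ0.le y hy).trans ?_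
  have h1 : n ^ (-E) ≤ a ^ (-E) * D ^ (E / M) := by
    refine (Real.rpow_le_rpow_of_nonpos (by positivity) hn1 (by linarith [h.hE0])).trans
      (le_of_eq ?_)
    rw [Real.mul_rpow ha.le hN0.le, ← Real.rpow_mul hD0.le]
    congr 2
    ring
  have h2 : n ^ (M - E) ≤ b ^ (M - E) * (D ^ (E / M) / D) := by
    refine (Real.rpow_le_rpow hn0.le hn2 (by linarith [h.E_le_M])).trans (le_of_eq ?_)
    rw [Real.mul_rpow hb.le hN0.le, ← Real.rpow_mul hD0.le, ← Real.rpow_sub_one hD0.ne']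
    congr 2
    field_simp
    ring
  have hδD : δ = Λ δ * D := by rw [hD]; field_simp
  calc _ ≤ C * (R * (a ^ (-E) * D ^ (E / M)) * L₁ ^ (1 - 1 / s) +
        δ * (b ^ (M - E) * (D ^ (E / M) / D)) * L₂ ^ (1 - ip)) := by gcongr
    _ = C * (R * (a ^ (-E) * D ^ (E / M)) * L₁ ^ (1 - 1 / s) +
        b ^ (M - E) * D ^ (E / M) * (Λ δ * L₂ ^ (1 - ip))) := by
        congr 2
        nth_rewrite 1 [hδD]
        field_simp
    _ ≤ C * (R * (a ^ (-E) * D ^ (E / M)) * (c * G δ) +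
        b ^ (M - E) * D ^ (E / M) * (c * G δ)) := by gcongr
    _ = _ := by ring

theorem log_one_div_le {δ δ₀ : ℝ} (hδ : δ ∈ Ioc 0 δ₀) : Real.log (1 / δ₀) ≤ Real.log (1 / δ) :=
  Real.log_le_log (one_div_pos.2 (hδ.1.trans_le hδ.2)) (one_div_le_one_div_of_le hδ.1 hδ.2)

theorem log_one_div_pos {δ : ℝ} (hδ : δ ∈ Ioo (0 : ℝ) 1) : 0 < Real.log (1 / δ) :=
  Real.log_pos (by rw [lt_div_iff₀ hδ.1]; linarith [hδ.2])

/-- Powers of `log (1/δ)` in the relation `n ≍ N(δ)` do not affect the order of `log n`. -/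
theorem exists_one_add_posLog_le {M δ₀ : ℝ} (hM : 0 < M) (hδ₀ : δ₀ ∈ Ioo (0 : ℝ) 1) (κ : ℝ)
    {b : ℝ} (hb : 0 < b) : ∃ c : ℝ, 0 < c ∧ ∀ δ ∈ Ioc 0 δ₀, ∀ n : ℝ, 0 < n →
      n ≤ b * (δ / Real.log (1 / δ) ^ κ) ^ (-(1 / M)) →
      1 + Real.posLog n ≤ c * Real.log (1 / δ) := by
  set l := Real.log (1 / δ₀)
  have hl0 : 0 < l := log_one_div_pos hδ₀
  refine ⟨(1 + |Real.log b|) / l + 1 / M * (1 + |κ| * (1 + 1 / l ^ 2)), by positivity, ?_⟩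
  intro δ hδ n hn hle
  have hL : l ≤ Real.log (1 / δ) := log_one_div_le hδ
  have hlogδ : Real.log δ = -Real.log (1 / δ) := by rw [one_div, Real.log_inv, neg_neg]
  set L := Real.log (1 / δ)
  have hL0 : 0 < L := hl0.trans_le hL
  have hlogL : |Real.log L| ≤ L * (1 + 1 / l ^ 2) := by
    have h1 : Real.log L ≤ L := (Real.log_le_sub_one_of_pos hL0).trans (by linarith)
    have h2 : -Real.log L ≤ 1 / L := by
      have := Real.log_le_sub_one_of_pos (inv_pos.2 hL0)
      rw [Real.log_inv] at this
      rw [one_div]; linarith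
    have h3 : 1 / L ≤ L * (1 / l ^ 2) := by
      rw [mul_one_div, div_le_div_iff₀ hL0 (by positivity)]
      nlinarith
    have h4 : 0 ≤ L * (1 / l ^ 2) := by positivity
    rw [abs_le]
    constructor <;> linarith
  have hlog : Real.log n ≤ |Real.log b| + 1 / M * (L + |κ| * |Real.log L|) := by
    have hD0 : 0 < δ / L ^ κ := div_pos hδ.1 (by positivity)
    refine (Real.log_le_log hn hle).trans ?_
    rw [Real.log_mul hb.ne' (by positivity), Real.log_rpow hD0,
      Real.log_div hδ.1.ne' (by positivity), Real.log_rpow hL0, hlogδ]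
    have h1 : κ * Real.log L ≤ |κ| * |Real.log L| := by
      rw [← abs_mul]; exact le_abs_self _
    have h2 : 1 / M * (L + κ * Real.log L) ≤ 1 / M * (L + |κ| * |Real.log L|) := by gcongr
    linarith [le_abs_self (Real.log b)]
  have hn' : Real.posLog n ≤ |Real.log b| + 1 / M * (L + |κ| * |Real.log L|) := by
    rw [Real.posLog]
    exact max_le (by positivity) hlog
  have h5 : 1 + |Real.log b| ≤ (1 + |Real.log b|) / l * L := by
    rw [div_mul_eq_mul_div, le_div_iff₀ hl0]
    gcongr
  calc 1 + Real.posLog n ≤ (1 + |Real.log b|) + 1 / M * (L + |κ| * |Real.log L|) := by linarith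
    _ ≤ (1 + |Real.log b|) / l * L + 1 / M * (L + |κ| * (L * (1 + 1 / l ^ 2))) := by gcongr
    _ = _ := by ring

theorem one_le_mul_log_rpow {δ δ₀ t : ℝ} (hδ₀ : δ₀ ∈ Ioo (0 : ℝ) 1) (hδ : δ ∈ Ioc 0 δ₀)
    (ht : 0 ≤ t) : 1 ≤ (Real.log (1 / δ₀) ^ t)⁻¹ * Real.log (1 / δ) ^ t := by
  have hl0 := log_one_div_pos hδ₀
  rw [inv_mul_eq_div, one_le_div (by positivity)]
  exact Real.rpow_le_rpow hl0.le (log_one_div_le hδ) ht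

section Cases

variable {s μ : ℝ} {p : ℝ≥0∞} {r₁ r₂ : ℕ} {ip M E γ : ℝ}

theorem uniformErrorBound_subcritical (h : IsSetting s μ p r₁ r₂ ip M E) (hγ : 1 ≤ γ)
    (hr : r₂ < r₁) (hcrit : γ * E < E + 2 * ((r₁ : ℝ) - r₂)) :
    UniformErrorBound s μ p r₁ r₂ γ (Ioo 0 1) (fun δ => δ ^ (-(1 / M))) (fun δ => δ ^ (E / M)) := by
  refine (uniformErrorBound_of_logFactor_le h hγ hcrit.le (Δ := Ioo 0 1) (Λ := fun _ => 1)
    (G := fun _ => 1) (fun δ hδ => hδ.1) (fun _ _ => one_pos) fun b hb => ?_).congr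
    (fun δ _ => by simp) (fun δ _ => by simp)
  exact ⟨1, one_pos, fun δ _ n _ _ =>
    ⟨1, 1, Or.inl ⟨hcrit, rfl⟩, Or.inl ⟨hr, rfl⟩, by simp, by simp⟩⟩

theorem uniformErrorBound_subcritical_mul_log (h : IsSetting s μ p r₁ r₂ ip M E) (hγ : 1 ≤ γ)
    (hr : r₂ < r₁) (hcrit : γ * E < E + 2 * ((r₁ : ℝ) - r₂)) {δ₀ : ℝ}
    (hδ₀ : δ₀ ∈ Ioo (0 : ℝ) 1) :
    UniformErrorBound s μ p r₁ r₂ γ (Ioc 0 δ₀) (fun δ => δ ^ (-(1 / M)))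
      (fun δ => δ ^ (E / M) * Real.log (1 / δ)) := by
  refine (uniformErrorBound_of_logFactor_le h hγ hcrit.le (Δ := Ioc 0 δ₀) (Λ := fun _ => 1)
    (G := fun δ => Real.log (1 / δ)) (fun δ hδ => hδ.1) (fun _ _ => one_pos) fun b hb => ?_).congr
    (fun δ _ => by simp) (fun δ _ => by simp)
  have hl0 := log_one_div_pos hδ₀
  refine ⟨(Real.log (1 / δ₀))⁻¹, by positivity, fun δ hδ n _ _ =>
    ⟨1, 1, Or.inl ⟨hcrit, rfl⟩, Or.inl ⟨hr, rfl⟩, ?_⟩⟩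
  have := one_le_mul_log_rpow hδ₀ hδ zero_le_one
  rw [Real.rpow_one, Real.rpow_one] at this
  simpa using this

theorem uniformErrorBound_subcritical_log_rpow (h : IsSetting s μ p r₁ r₂ ip M E) (hγ : 1 ≤ γ)
    (hr : r₂ < r₁) (hcrit : γ * E < E + 2 * ((r₁ : ℝ) - r₂)) {δ₀ : ℝ}
    (hδ₀ : δ₀ ∈ Ioo (0 : ℝ) 1) {t : ℝ} (ht : 0 ≤ t) :
    UniformErrorBound s μ p r₁ r₂ γ (Ioc 0 δ₀)
      (fun δ => (δ / Real.log (1 / δ) ^ t) ^ (-(1 / M)))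
      (fun δ => (δ / Real.log (1 / δ) ^ t) ^ (E / M) * Real.log (1 / δ) ^ t) := by
  have hl0 := log_one_div_pos hδ₀
  have hL0 : ∀ δ ∈ Ioc 0 δ₀, 0 < Real.log (1 / δ) := fun δ hδ => hl0.trans_le (log_one_div_le hδ)
  refine uniformErrorBound_of_logFactor_le h hγ hcrit.le (Δ := Ioc 0 δ₀)
    (Λ := fun δ => Real.log (1 / δ) ^ t) (G := fun δ => Real.log (1 / δ) ^ t)
    (fun δ hδ => hδ.1) (fun δ hδ => Real.rpow_pos_of_pos (hL0 δ hδ) _) fun b hb => ?_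
  refine ⟨max 1 (Real.log (1 / δ₀) ^ t)⁻¹, by positivity, fun δ hδ n _ _ =>
    ⟨1, 1, Or.inl ⟨hcrit, rfl⟩, Or.inl ⟨hr, rfl⟩, ?_, ?_⟩⟩
  · have hLt := Real.rpow_nonneg (hL0 δ hδ).le t
    rw [Real.one_rpow]
    exact (one_le_mul_log_rpow hδ₀ hδ ht).trans
      (mul_le_mul_of_nonneg_right (le_max_right _ _) hLt)
  · rw [Real.one_rpow, mul_one]
    exact le_mul_of_one_le_left (Real.rpow_nonneg (hL0 δ hδ).le t) (le_max_left _ _)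

theorem uniformErrorBound_log (h : IsSetting s μ p r₁ r₂ ip M E) (hγ : 1 ≤ γ)
    (hr : r₂ < r₁) (hcrit : γ * E ≤ E + 2 * ((r₁ : ℝ) - r₂)) {δ₀ : ℝ}
    (hδ₀ : δ₀ ∈ Ioo (0 : ℝ) 1) :
    UniformErrorBound s μ p r₁ r₂ γ (Ioc 0 δ₀)
      (fun δ => (δ / Real.log (1 / δ)) ^ (-(1 / M)))
      (fun δ => (δ / Real.log (1 / δ)) ^ (E / M) * Real.log (1 / δ)) := by
  have hl0 := log_one_div_pos hδ₀
  have hL0 : ∀ δ ∈ Ioc 0 δ₀, 0 < Real.log (1 / δ) := fun δ hδ => hl0.trans_le (log_one_div_le hδ)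
  refine uniformErrorBound_of_logFactor_le h hγ hcrit (Δ := Ioc 0 δ₀)
    (Λ := fun δ => Real.log (1 / δ)) (G := fun δ => Real.log (1 / δ))
    (fun δ hδ => hδ.1) hL0 fun b hb => ?_
  obtain ⟨c, hc, hn⟩ := exists_one_add_posLog_le h.M_pos hδ₀ 1 hb
  refine ⟨max 1 c, by positivity, fun δ hδ n hn0 hle =>
    ⟨1 + Real.posLog n, 1, Or.inr rfl, Or.inl ⟨hr, rfl⟩, ?_, ?_⟩⟩
  · have h1 := hn δ hδ n hn0 (by rwa [Real.rpow_one])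
    have h2 : (1 + Real.posLog n) ^ (1 - 1 / s) ≤ (1 + Real.posLog n) ^ (1 : ℝ) :=
      Real.rpow_le_rpow_of_exponent_le (by linarith [Real.posLog_nonneg (x := n)])
        (by linarith [h.one_div_s_pos])
    rw [Real.rpow_one] at h2
    exact h2.trans (h1.trans (mul_le_mul_of_nonneg_right (le_max_right _ _) (hL0 δ hδ).le))
  · rw [Real.one_rpow, mul_one]
    exact le_mul_of_one_le_left (hL0 δ hδ).le (le_max_left _ _)

/-- For equal orders of differentiation the critical case of the truncation error and that of the
data error occur together, at `γ = 1`. -/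
theorem uniformErrorBound_diagonal (h : IsSetting s μ p r₁ r₂ ip M E) {δ₀ : ℝ}
    (hδ₀ : δ₀ ∈ Ioo (0 : ℝ) 1) :
    UniformErrorBound s μ p r₁ r₂ 1 (Ioc 0 δ₀)
      (fun δ => (δ / Real.log (1 / δ) ^ (ip - 1 / s)) ^ (-(1 / M)))
      (fun δ => (δ * Real.log (1 / δ) ^ (1 / s - ip)) ^ (E / M) *
        Real.log (1 / δ) ^ (2 - 1 / s)) := by
  have hl0 := log_one_div_pos hδ₀
  have hL0 : ∀ δ ∈ Ioc 0 δ₀, 0 < Real.log (1 / δ) := fun δ hδ => hl0.trans_le (log_one_div_le hδ)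
  have hr' : (r₂ : ℝ) ≤ r₁ := by exact_mod_cast h.hr
  refine (uniformErrorBound_of_logFactor_le h le_rfl (by linarith) (Δ := Ioc 0 δ₀)
    (Λ := fun δ => Real.log (1 / δ) ^ (ip - 1 / s)) (G := fun δ => Real.log (1 / δ) ^ (2 - 1 / s))
    (fun δ hδ => hδ.1) (fun δ hδ => Real.rpow_pos_of_pos (hL0 δ hδ) _) fun b hb => ?_).congr
    (fun _ _ => rfl) (fun δ hδ => ?_)
  · obtain ⟨c, hc, hn⟩ := exists_one_add_posLog_le h.M_pos hδ₀ (ip - 1 / s) hb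
    have hs1 := h.one_div_s_le
    have hp1 := h.ip_le_one
    refine ⟨(c ^ (1 - 1 / s) + c ^ (1 - ip)) * (Real.log (1 / δ₀))⁻¹, by positivity,
      fun δ hδ n hn0 hle => ⟨_, _, Or.inr rfl, Or.inr rfl, ?_⟩⟩
    have hL := hL0 δ hδ
    have h1 := hn δ hδ n hn0 hle
    have hpl := Real.posLog_nonneg (x := n)
    have hone := one_le_mul_log_rpow hδ₀ hδ zero_le_one
    rw [Real.rpow_one, Real.rpow_one] at hone
    set L := Real.log (1 / δ)
    have hLt : L ^ (1 - 1 / s) ≤ (Real.log (1 / δ₀))⁻¹ * L ^ (2 - 1 / s) := by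
      rw [show 2 - 1 / s = 1 + (1 - 1 / s) by ring, Real.rpow_add hL, Real.rpow_one, ← mul_assoc]
      exact le_mul_of_one_le_left (by positivity) hone
    have hc1 : 0 ≤ c ^ (1 - 1 / s) := by positivity
    have hc2 : 0 ≤ c ^ (1 - ip) := by positivity
    have hLt0 : 0 < L ^ (1 - 1 / s) := by positivity
    constructor
    · calc (1 + Real.posLog n) ^ (1 - 1 / s) ≤ (c * L) ^ (1 - 1 / s) :=
            Real.rpow_le_rpow (by linarith) h1 (by linarith)
        _ = c ^ (1 - 1 / s) * L ^ (1 - 1 / s) := Real.mul_rpow hc.le hL.le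
        _ ≤ (c ^ (1 - 1 / s) + c ^ (1 - ip)) * ((Real.log (1 / δ₀))⁻¹ * L ^ (2 - 1 / s)) :=
            mul_le_mul (by linarith) hLt hLt0.le (by linarith)
        _ = _ := by ring
    · calc L ^ (ip - 1 / s) * (1 + Real.posLog n) ^ (1 - ip)
          ≤ L ^ (ip - 1 / s) * (c * L) ^ (1 - ip) := by
            gcongr
        _ = c ^ (1 - ip) * L ^ (1 - 1 / s) := by
            rw [Real.mul_rpow hc.le hL.le,
              show 1 - 1 / s = (ip - 1 / s) + (1 - ip) by ring, Real.rpow_add hL]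
            ring
        _ ≤ (c ^ (1 - 1 / s) + c ^ (1 - ip)) * ((Real.log (1 / δ₀))⁻¹ * L ^ (2 - 1 / s)) :=
            mul_le_mul (by linarith) hLt hLt0.le (by linarith)
        _ = _ := by ring
  · have hL := hL0 δ hδ
    rw [show 1 / s - ip = -(ip - 1 / s) by ring, Real.rpow_neg hL.le, ← div_eq_mul_inv]

end Cases

end FourierLegendre

theorem theorem2 (s μ : ℝ) (p : ℝ≥0∞) (r₁ r₂ : ℕ)
    (hs : 1 ≤ s) (hp : 1 ≤ p) (hr₂ : 1 ≤ r₂) (hr : r₂ ≤ r₁)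
    (hμ : 2 * r₁ - 1 / s + 3 / 2 < μ)
    -- the numbers `1/p` (zero for `p = ∞`), `μ - 1/p + 1/s` and `μ - 2r₁ + 1/s - 3/2`
    (ip M E : ℝ) (hip : ip = (p⁻¹).toReal) (hM : M = μ - ip + 1 / s)
    (hE : E = μ - 2 * r₁ + 1 / s - 3 / 2) :
    -- the series of the mixed derivative converges in `C(Q)`
    (∀ f ∈ FourierLegendre.smoothSpace s μ, Summable (FourierLegendre.derivTerm r₁ r₂ f)) ∧
    -- I
    (r₁ = r₂ → ∀ δ₀ ∈ Ioo (0 : ℝ) 1,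
      FourierLegendre.UniformErrorBound s μ p r₁ r₂ 1 (Ioc 0 δ₀)
        (fun δ => (δ / Real.log (1 / δ) ^ (ip - 1 / s)) ^ (-(1 / M)))
        (fun δ => (δ * Real.log (1 / δ) ^ (1 / s - ip)) ^ (E / M) *
          Real.log (1 / δ) ^ (2 - 1 / s))) ∧
    -- II
    (r₁ = r₂ + 1 →
      -- a
      (∀ δ₀ ∈ Ioo (0 : ℝ) 1,
        FourierLegendre.UniformErrorBound s μ p r₁ r₂ 1 (Ioc 0 δ₀)
          (fun δ => δ ^ (-(1 / M)))
          (fun δ => δ ^ (E / M) * Real.log (1 / δ))) ∧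
      -- b
      (∀ γ ∈ Ioo 1 ((μ - 2 * r₁ + 1 / s + 5 / 2) / (μ - 2 * r₁ + 1 / s + 1 / 2)) ∪
          Ioo ((μ - 2 * r₁ + 1 / s + 5 / 2) / (μ - 2 * r₁ + 1 / s + 1 / 2))
            ((μ - 2 * r₁ + 1 / s + 1 / 2) / (μ - 2 * r₁ + 1 / s - 3 / 2)),
        FourierLegendre.UniformErrorBound s μ p r₁ r₂ γ (Ioo 0 1)
          (fun δ => δ ^ (-(1 / M)))
          (fun δ => δ ^ (E / M))) ∧
      -- c
      (∀ γ, γ = (μ - 2 * r₁ + 1 / s + 1 / 2) / (μ - 2 * r₁ + 1 / s - 3 / 2) →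
        ∀ δ₀ ∈ Ioo (0 : ℝ) 1,
        FourierLegendre.UniformErrorBound s μ p r₁ r₂ γ (Ioc 0 δ₀)
          (fun δ => (δ / Real.log (1 / δ)) ^ (-(1 / M)))
          (fun δ => (δ / Real.log (1 / δ)) ^ (E / M) * Real.log (1 / δ))) ∧
      -- d
      (∀ γ, γ = (μ - 2 * r₁ + 1 / s + 5 / 2) / (μ - 2 * r₁ + 1 / s + 1 / 2) →
        ∀ δ₀ ∈ Ioo (0 : ℝ) 1,
        FourierLegendre.UniformErrorBound s μ p r₁ r₂ γ (Ioc 0 δ₀)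
          (fun δ => (δ / Real.log (1 / δ) ^ (1 - 1 / s)) ^ (-(1 / M)))
          (fun δ => (δ / Real.log (1 / δ) ^ (1 - 1 / s)) ^ (E / M) *
            Real.log (1 / δ) ^ (1 - 1 / s)))) ∧
    -- III
    (r₂ + 1 < r₁ →
      -- a
      (∀ γ ∈ Ico 1 ((μ - 2 * r₂ + 1 / s - 3 / 2) / (μ - 2 * r₁ + 1 / s + 1 / 2)) ∪
          Ioo ((μ - 2 * r₂ + 1 / s - 3 / 2) / (μ - 2 * r₁ + 1 / s + 1 / 2))
            ((μ - 2 * r₂ + 1 / s + 1 / 2) / (μ - 2 * r₁ + 1 / s + 1 / 2)) ∪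
          Ioo ((μ - 2 * r₂ + 1 / s + 1 / 2) / (μ - 2 * r₁ + 1 / s + 1 / 2))
            ((μ - 2 * r₂ + 1 / s - 3 / 2) / (μ - 2 * r₁ + 1 / s - 3 / 2)),
        FourierLegendre.UniformErrorBound s μ p r₁ r₂ γ (Ioo 0 1)
          (fun δ => δ ^ (-(1 / M)))
          (fun δ => δ ^ (E / M))) ∧
      -- b
      (∀ γ, γ = (μ - 2 * r₂ + 1 / s - 3 / 2) / (μ - 2 * r₁ + 1 / s + 1 / 2) ∨
          γ = (μ - 2 * r₂ + 1 / s - 3 / 2) / (μ - 2 * r₁ + 1 / s - 3 / 2) →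
        ∀ δ₀ ∈ Ioo (0 : ℝ) 1,
        FourierLegendre.UniformErrorBound s μ p r₁ r₂ γ (Ioc 0 δ₀)
          (fun δ => (δ / Real.log (1 / δ)) ^ (-(1 / M)))
          (fun δ => (δ / Real.log (1 / δ)) ^ (E / M) * Real.log (1 / δ))) ∧
      -- c
      (∀ γ, γ = (μ - 2 * r₂ + 1 / s + 1 / 2) / (μ - 2 * r₁ + 1 / s + 1 / 2) →
        ∀ δ₀ ∈ Ioo (0 : ℝ) 1,
        FourierLegendre.UniformErrorBound s μ p r₁ r₂ γ (Ioc 0 δ₀)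
          (fun δ => (δ / Real.log (1 / δ) ^ (1 - 1 / s)) ^ (-(1 / M)))
          (fun δ => (δ / Real.log (1 / δ) ^ (1 - 1 / s)) ^ (E / M) *
            Real.log (1 / δ) ^ (1 - 1 / s)))) := by
  have hE0 : 0 < E := by rw [hE]; linarith
  have hS : FourierLegendre.IsSetting s μ p r₁ r₂ ip M E :=
    ⟨hs, hp, hr₂, hr, hip, hM, hE, hE0⟩
  have d1 : μ - 2 * r₁ + 1 / s - 3 / 2 = E := hE.symm
  have d2 : μ - 2 * r₁ + 1 / s + 1 / 2 = E + 2 := by rw [hE]; ring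
  have d3 : μ - 2 * r₁ + 1 / s + 5 / 2 = E + 4 := by rw [hE]; ring
  have d4 : μ - 2 * r₂ + 1 / s - 3 / 2 = E + 2 * ((r₁ : ℝ) - r₂) := by rw [hE]; ring
  have d5 : μ - 2 * r₂ + 1 / s + 1 / 2 = E + 2 * ((r₁ : ℝ) - r₂) + 2 := by rw [hE]; ring
  rw [d1, d2, d3, d4, d5]
  have hE2 : 0 < E + 2 := by linarith
  refine ⟨fun f hf => FourierLegendre.summable_derivTerm hs hr₂ hr hμ hf,
    fun _ δ₀ hδ₀ => FourierLegendre.uniformErrorBound_diagonal hS hδ₀, fun h => ?_, fun h => ?_⟩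
  · have hlt : r₂ < r₁ := by omega
    have hd : (r₁ : ℝ) - r₂ = 1 := by rw [h]; push_cast; ring
    -- the critical exponent is `(E + 2) / E`
    have below : ∀ γ, γ < (E + 2) / E → γ * E < E + 2 * ((r₁ : ℝ) - r₂) := fun γ hγ => by
      rw [hd]; rw [lt_div_iff₀ hE0] at hγ; linarith
    have h42 : (E + 4) / (E + 2) < (E + 2) / E := by
      rw [div_lt_div_iff₀ hE2 hE0]; nlinarith
    have h42' : 1 ≤ (E + 4) / (E + 2) := by rw [one_le_div hE2]; linarith
    have h20 : 1 ≤ (E + 2) / E := by rw [one_le_div hE0]; linarith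
    refine ⟨fun δ₀ hδ₀ => ?_, fun γ hγ => ?_, fun γ hγ δ₀ hδ₀ => ?_, fun γ hγ δ₀ hδ₀ => ?_⟩
    · exact FourierLegendre.uniformErrorBound_subcritical_mul_log hS le_rfl hlt
        (by rw [hd]; linarith) hδ₀
    · refine FourierLegendre.uniformErrorBound_subcritical hS ?_ hlt (below γ ?_)
      · rcases hγ with hγ | hγ
        · exact hγ.1.le
        · exact h42'.trans hγ.1.le
      · rcases hγ with hγ | hγ
        · exact hγ.2.trans h42
        · exact hγ.2
    · subst hγ
      refine FourierLegendre.uniformErrorBound_log hS h20 hlt (le_of_eq ?_) hδ₀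
      rw [hd, div_mul_cancel₀ _ hE0.ne', mul_one]
    · subst hγ
      exact FourierLegendre.uniformErrorBound_subcritical_log_rpow hS h42' hlt (below _ h42) hδ₀
        (by linarith [hS.one_div_s_le])
  · have hlt : r₂ < r₁ := by omega
    have hd : 2 ≤ (r₁ : ℝ) - r₂ := by
      have : ((r₂ + 2 : ℕ) : ℝ) ≤ r₁ := by exact_mod_cast h
      push_cast at this
      linarith
    set d := (r₁ : ℝ) - r₂
    -- the critical exponent is `(E + 2d) / E`
    have below : ∀ γ, γ < (E + 2 * d) / E → γ * E < E + 2 * d := fun γ hγ => by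
      rwa [lt_div_iff₀ hE0] at hγ
    have ha : 1 ≤ (E + 2 * d) / (E + 2) := by rw [one_le_div hE2]; linarith
    have hab : (E + 2 * d) / (E + 2) ≤ (E + 2 * d + 2) / (E + 2) :=
      div_le_div_of_nonneg_right (by linarith) hE2.le
    have hbc : (E + 2 * d + 2) / (E + 2) < (E + 2 * d) / E := by
      rw [div_lt_div_iff₀ hE2 hE0]; nlinarith
    refine ⟨fun γ hγ => ?_, fun γ hγ δ₀ hδ₀ => ?_, fun γ hγ δ₀ hδ₀ => ?_⟩
    · refine FourierLegendre.uniformErrorBound_subcritical hS ?_ hlt (below γ ?_)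
      · rcases hγ with (hγ | hγ) | hγ
        · exact hγ.1
        · exact ha.trans hγ.1.le
        · exact (ha.trans hab).trans hγ.1.le
      · rcases hγ with (hγ | hγ) | hγ
        · exact hγ.2.trans (hab.trans_lt hbc)
        · exact hγ.2.trans hbc
        · exact hγ.2
    · rcases hγ with rfl | rfl
      · exact FourierLegendre.uniformErrorBound_log hS ha hlt (below _ (hab.trans_lt hbc)).le hδ₀
      · refine FourierLegendre.uniformErrorBound_log hS ?_ hlt (le_of_eq ?_) hδ₀
        · exact (ha.trans hab).trans hbc.le
        · rw [div_mul_cancel₀ _ hE0.ne']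
    · subst hγ
      exact FourierLegendre.uniformErrorBound_subcritical_log_rpow hS (ha.trans hab) hlt
        (below _ hbc) hδ₀ (by linarith [hS.one_div_s_le])
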